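/- **Setting.** Let $n,m,T\ge 1$ and let $\mathcal X\subset\mathbb R^n$, $\mathcal Y\subset\mathbb R^m$ be nonempty, compact and convex, with Euclidean diameters $D_x,D_y$; put $D=\max\{D_x,D_y\}$ and $d=\max\{n,m\}$. Let $f$ be convex-concave on $\mathcal X\times\mathcal Y$ ($f(\cdot,y)$ convex on $\mathcal X$ for each $y\in\mathcal Y$, $f(x,\cdot)$ concave on $\mathcal Y$ for each $x\in\mathcal X$), with partial gradients satisfying, for some $L>0$ and all $x_1,x_2\in\mathcal X$, $y_1,y_2\in\mathcal Y$, $$\|\nabla_x f(x_1,y_1)-\nabla_x f(x_2,y_2)\|\le L(\|x_1-x_2\|+\|y_1-y_2\|),\qquad \|\nabla_y f(x_1,y_1)-\nabla_y f(x_2,y_2)\|\le L(\|x_1-x_2\|+\|y_1-y_2\|).$$ A sample $\xi\sim\mathcal D$ gives noisy gradients $g_x(x,y;\xi)$, $g_y(x,y;\xi)$ which, at every $(x,y)\in\mathcal X\times\mathcal Y$, are unbiased for $\nabla_xf(x,y)$, $\nabla_yf(x,y)$ and whose $j$-th (resp. $k$-th) component has variance at most $\sigma_x^2(j)$ (resp.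 $\sigma_y^2(k)$). Let $\sigma=\max\big\{\sqrt{\sum_j\sigma_x^2(j)},\sqrt{\sum_k\sigma_y^2(k)}\big\}$. **Agents.** There are $M$ agents ($M$ even). A fixed set $\mathcal B$ of at most $\alpha M$ of them is Byzantine. Communication takes place in stages. In each stage the server sends a point $(x,y)$ to all agents; each normal agent $i\notin\mathcal B$ draws a fresh sample $\xi^{(i)}\sim\mathcal D$ (independent across agents, and jointly independent of everything before this stage) and returns $g_x(x,y;\xi^{(i)}),g_y(x,y;\xi^{(i)})$. Byzantine agents return arbitrary vectors, which may depend on everything that happened before, on all samples of the current stage and on additional randomness, but not on samples still to be drawn by the normal agents. **Trimmed mean.** Given $M$ real numbers $Z_1,\dots,Z_{M/2},\tilde Z_1,\dots,\tilde Z_{M/2}$ and $\alpha,\delta$, put $\epsilon=8\alpha+24\log(4/\delta)/M$, let $Z^*_1\le\dots\le Z^*_{M/2}$ be the sorted first half, and let $\gamma=Z^*_{\lceil\epsilon M/2\rceil}$, $\beta=Z^*_{\lceil(1-\epsilon)M/2\rceil}$. The estimate is $\frac2M\sum_{i=1}^{M/2}\phi_{\gamma,\beta}(\tilde Z_i)$,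 where $\phi_{\gamma,\beta}(x)$ is $\beta$ for $x>\beta$, $\gamma$ for $x<\gamma$, and $x$ otherwise. $\mathrm{Trim}$ applies this to each coordinate of $M$ vectors. **Algorithm RDEG.** From deterministic $x_1\in\mathcal X$, $y_1\in\mathcal Y$, for $t=1,\dots,T$: query the agents at $(x_t,y_t)$ and let $\tilde g_x(x_t,y_t),\tilde g_y(x_t,y_t)$ be the $\mathrm{Trim}$ of the answers; set $\hat x_t=\Pi_{\mathcal X}(x_t-\eta\tilde g_x(x_t,y_t))$, $\hat y_t=\Pi_{\mathcal Y}(y_t+\eta\tilde g_y(x_t,y_t))$; query again at $(\hat x_t,\hat y_t)$ and set $x_{t+1}=\Pi_{\mathcal X}(x_t-\eta\tilde g_x(\hat x_t,\hat y_t))$, $y_{t+1}=\Pi_{\mathcal Y}(y_t+\eta\tilde g_y(\hat x_t,\hat y_t))$, where $\Pi$ is Euclidean projection. Let $\bar x_T=\frac1T\sum_{t\le T}\hat x_t$, $\bar y_T=\frac1T\sum_{t\le T}\hat y_t$ and $\phi_T=\max_{y\in\mathcal Y}f(\bar x_T,y)-\min_{x\in\mathcal X}f(x,\bar y_T)$.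 **Theorem.** There are universal constants $C>0$ and $p\in\mathbb N$ such that the following holds in every such setting. Let $\alpha\in[0,1/16)$, $M\ge 48\log(16dT^2)$, $0<\eta\le 1/(2L)$ and $\delta=1/(4dT^2)$, and let the trimming level satisfy $\epsilon=8\alpha+24\log(16dT^2)/M\le 1/2$ (so that the lower truncation quantile does not exceed the upper one). Then, with probability at least $1-1/T$, $$\phi_T\le\frac{D^2}{\eta T}+C\,(1+\log d+\log T)^p\,\sigma D\Big(\sqrt\alpha+\sqrt{1/M}\Big).$$ -/

import Mathlib

open MeasureTheory ProbabilityTheory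

noncomputable section

namespace RDEG

/-- `ℝ^n` with its Euclidean norm. -/
abbrev Vec (n : ℕ) := EuclideanSpace ℝ (Fin n)

/-! ### The univariate trimmed mean and its coordinatewise version -/

/-- The `r`-th smallest (`1 ≤ r ≤ N`) of the `N` numbers `z`: the entry of rank `r` in a
non-decreasing arrangement. -/
def orderStat {N : ℕ} (z : Fin N → ℝ) (r : ℕ) : ℝ :=
  if h : r - 1 < N then z (Tuple.sort z ⟨r - 1, h⟩) else 0

/-- Truncation of `x` to the levels `γ ≤ β`. -/
def truncate (γ β x : ℝ) : ℝ :=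
  if β < x then β else if x < γ then γ else x

/-- The trimming parameter `ε = 8 α + 24 log (4 / δ) / M`. -/
def trimLevel (M : ℕ) (α δ : ℝ) : ℝ :=
  8 * α + 24 * (Real.log (4 / δ) / M)

/-- First half of the data set. -/
def firstHalf {M : ℕ} (z : Fin M → ℝ) : Fin (M / 2) → ℝ :=
  fun i => z ⟨i, by omega⟩

/-- Second half of the data set. -/
def secondHalf {M : ℕ} (z : Fin M → ℝ) : Fin (M / 2) → ℝ :=
  fun i => z ⟨M / 2 + i, by omega⟩

/-- The univariate trimmed-mean estimator of Lugosi and Mendelson: the first half of the data gives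
the empirical quantiles of levels `ε` and `1 - ε`, the second half is truncated there and averaged.
A rank that is not an integer is rounded up. -/
def trimmedMean {M : ℕ} (α δ : ℝ) (z : Fin M → ℝ) : ℝ :=
  let ε := trimLevel M α δ
  let γ := orderStat (firstHalf z) ⌈ε * ((M : ℝ) / 2)⌉₊
  let β := orderStat (firstHalf z) ⌈(1 - ε) * ((M : ℝ) / 2)⌉₊
  (2 / (M : ℝ)) * ∑ i, truncate γ β (secondHalf z i)

/-- The operator `Trim`: the trimmed mean applied to each coordinate of `M` vectors. -/
def trim {M k : ℕ} (α δ : ℝ) (v : Fin M → Vec k) : Vec k :=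
  WithLp.toLp 2 fun j => trimmedMean α δ fun i => v i j

/-! ### The algorithm -/

/-- Euclidean projection: the point of `K` nearest to `u` (it exists and is unique for `K`
nonempty, closed and convex). -/
def proj {k : ℕ} (K : Set (Vec k)) (u : Vec k) : Vec k :=
  Classical.epsilon fun v => v ∈ K ∧ ∀ w ∈ K, ‖u - v‖ ≤ ‖u - w‖

section Algorithm

variable {n m M : ℕ}

/-- One projected primal-dual update: it starts from `z` and uses the robust gradients computed
from the messages `rx`, `ry` that the agents send when they are queried at `u`. -/
def update (X : Set (Vec n)) (Y : Set (Vec m)) (η α δ : ℝ)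
    (rx : Vec n → Vec m → Fin M → Vec n) (ry : Vec n → Vec m → Fin M → Vec m)
    (z u : Vec n × Vec m) : Vec n × Vec m :=
  (proj X (z.1 - η • trim α δ (rx u.1 u.2)), proj Y (z.2 + η • trim α δ (ry u.1 u.2)))

/-- The iterates of RDEG, started at `z₁`. Rounds are counted from `0`; round `t` consists of
the communication stages `2 t` (query at the iterate) and `2 t + 1` (query at the mid-point);
`rx s x y i`, `ry s x y i` are the messages of agent `i` in stage `s` when queried at `(x, y)`. -/
def iterate (X : Set (Vec n)) (Y : Set (Vec m)) (η α δ : ℝ)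
    (rx : ℕ → Vec n → Vec m → Fin M → Vec n) (ry : ℕ → Vec n → Vec m → Fin M → Vec m)
    (z₁ : Vec n × Vec m) : ℕ → Vec n × Vec m
  | 0 => z₁
  | t + 1 =>
    let z := iterate X Y η α δ rx ry z₁ t
    let zhat := update X Y η α δ (rx (2 * t)) (ry (2 * t)) z z
    update X Y η α δ (rx (2 * t + 1)) (ry (2 * t + 1)) z zhat

/-- The mid-point of round `t`. -/
def midpoint (X : Set (Vec n)) (Y : Set (Vec m)) (η α δ : ℝ)
    (rx : ℕ → Vec n → Vec m → Fin M → Vec n) (ry : ℕ → Vec n → Vec m → Fin M → Vec m)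
    (z₁ : Vec n × Vec m) (t : ℕ) : Vec n × Vec m :=
  let z := iterate X Y η α δ rx ry z₁ t
  update X Y η α δ (rx (2 * t)) (ry (2 * t)) z z

/-- The average of the first `T` mid-points. -/
def avgMidpoint (X : Set (Vec n)) (Y : Set (Vec m)) (η α δ : ℝ)
    (rx : ℕ → Vec n → Vec m → Fin M → Vec n) (ry : ℕ → Vec n → Vec m → Fin M → Vec m)
    (z₁ : Vec n × Vec m) (T : ℕ) : Vec n × Vec m :=
  (1 / (T : ℝ)) • ∑ t ∈ Finset.range T, midpoint X Y η α δ rx ry z₁ t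

/-- The primal-dual gap `max_{y ∈ Y} f (x̄, y) - min_{x ∈ X} f (x, ȳ)`. -/
def gap (X : Set (Vec n)) (Y : Set (Vec m)) (f : Vec n → Vec m → ℝ) (z : Vec n × Vec m) : ℝ :=
  sSup ((fun y => f z.1 y) '' Y) - sInf ((fun x => f x z.2) '' X)

/-! ### The stochastic oracle and the Byzantine agents -/

variable {Ξ Ω : Type*}

/-- The messages of the `M` agents in stage `s`: a Byzantine agent `i ∈ B` sends `b s i`, a normal
agent the oracle output `g (x, y; ξ s i)` at the query point. -/
def messages {k : ℕ} (B : Finset (Fin M)) (g : Vec n → Vec m → Ξ → Vec k)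
    (ξ : ℕ → Fin M → Ω → Ξ) (b : ℕ → Fin M → Ω → Vec k) (ω : Ω) :
    ℕ → Vec n → Vec m → Fin M → Vec k :=
  fun s x y i => if i ∈ B then b s i ω else g x y (ξ s i ω)

/-- `g (x, y; ξ)`, `ξ ∼ 𝒟`, is an unbiased estimate of `G (x, y)` for all `x ∈ X`, `y ∈ Y`, and the
variance of its `j`-th component is at most `(τ j)²`. -/
structure IsOracle [MeasurableSpace Ξ] {k : ℕ} (𝒟 : Measure Ξ) (X : Set (Vec n)) (Y : Set (Vec m))
    (G : Vec n → Vec m → Vec k) (g : Vec n → Vec m → Ξ → Vec k) (τ : Fin k → ℝ) : Prop where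
  measurable : Measurable fun p : Vec n × Vec m × Ξ => g p.1 p.2.1 p.2.2
  integrable : ∀ x ∈ X, ∀ y ∈ Y, Integrable (g x y) 𝒟
  unbiased : ∀ x ∈ X, ∀ y ∈ Y, ∫ ξ, g x y ξ ∂𝒟 = G x y
  integrable_sq : ∀ x ∈ X, ∀ y ∈ Y, ∀ j, Integrable (fun ξ => (g x y ξ j - G x y j) ^ 2) 𝒟
  variance_le : ∀ x ∈ X, ∀ y ∈ Y, ∀ j, ∫ ξ, (g x y ξ j - G x y j) ^ 2 ∂𝒟 ≤ τ j ^ 2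

/-- The normal agents draw i.i.d. samples from `𝒟`, afresh in every stage: `ℱ s` is everything that
is known before stage `s`, the samples of stage `s` are independent of it and revealed by `ℱ (s + 1)`.
The messages of the Byzantine agents in stage `s` are arbitrary, and may depend on all that happened
before and on all samples of the same stage (and on any randomness of their own that is
independent of the later samples of the normal agents). -/
structure IsExecution [MeasurableSpace Ξ] [mΩ : MeasurableSpace Ω] (μ : Measure Ω) (𝒟 : Measure Ξ)
    (B : Finset (Fin M)) (ℱ : Filtration ℕ mΩ) (ξ : ℕ → Fin M → Ω → Ξ)
    (bx : ℕ → Fin M → Ω → Vec n) (bz : ℕ → Fin M → Ω → Vec m) : Prop where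
  sample_measurable : ∀ s, ∀ i ∉ B, Measurable[ℱ (s + 1)] (ξ s i)
  sample_law : ∀ s, ∀ i ∉ B, μ.map (ξ s i) = 𝒟
  sample_indep : ∀ s, iIndepFun (fun i : {i : Fin M // i ∉ B} => ξ s i) μ
  sample_indep_past : ∀ s, Indep
    (MeasurableSpace.comap (fun ω (i : {i : Fin M // i ∉ B}) => ξ s i ω) inferInstance) (ℱ s) μ
  byzantine_measurable_x : ∀ s, ∀ i ∈ B, Measurable[ℱ (s + 1)] (bx s i)
  byzantine_measurable_y : ∀ s, ∀ i ∈ B, Measurable[ℱ (s + 1)] (bz s i)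

end Algorithm

end RDEG

end

/-!
The robust extragradient method is the exact one run with perturbed gradients, so the theorem splits
into a deterministic and a probabilistic half.

*Deterministic half.* Let every robust gradient in the first `T` rounds be within `E` of the true
one. The three-point inequality of the projection (`inner_proj_step_le`), applied to both
half-steps, bounds `⟪G, ẑ - w⟫` at the mid-point `ẑ` by a telescoping difference of squared distances
plus two kinds of terms: the smoothness terms, which `η ≤ 1 / (2 L)` absorbs into the negative
squares, and six error terms of size at most `E D` (`inner_midpoint_le`). Convexity-concavity turns
this into `gap ≤ D ^ 2 / (η T) + 6 E D` (`gap_avgMidpoint_le`).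

*Probabilistic half.* Fix a query point and a coordinate; let `X` be the centred message of a normal
agent, with variance at most `τ ^ 2`, and put `ε = trimLevel M α δ`, `K = 2 τ / √ε`. By Chebyshev
`|X|` exceeds `K` with probability at most `ε / 4`, and Byzantine agents make up at most a quarter of
the `ε M / 2` data trimmed on one side of a half. Hence, with high probability, both empirical
truncation levels lie in `[-K, K]`, and the lower one is at most a bound `c`, essentially the `4 ε`-quantile of `X`
(`cappedQuantile`). The levels depend on the first half, and hence on Byzantine messages that may
know the second half; but truncation is monotone in its levels, so the estimate is at most the mean
of `max c (min X K)` over the second half, with levels that are not random, plus the Byzantine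
share, which is `O(ε K)`. The mean of `max c (min X K)` is `O(ε K) = O(τ √ε)`, and all deviations are
controlled by one Bernstein bound for bounded summands (`measureReal_pi_le_exp`), each failing with
probability at most `exp (-ε M / 8) ≤ (δ / 4) ^ 3`. Applied to `X` and to `-X` this gives
`measureReal_overshoot_le` and, with the deterministic `abs_trimmedMean_sub_le`, an error of at most
`23 τ √ε` with probability at least `1 - δ`.

The query points are random but determined by the past (`measurable_iterate`), while the events
above involve fresh normal samples only, so Fubini transfers the bound to the actual run
(`measureReal_query_le`). A union bound over `2 T` stages and `n + m` coordinates costs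
`2 T (n + m) δ ≤ 1 / T`, and the errors of the coordinates add up in square to `E = 23 σ √ε`. Finally
`√ε` is at most `9 (1 + log d + log T) (√α + √(1 / M))` (`sqrt_trimLevel_le`).
-/

namespace RDEG

/-! ### Order statistics and truncation -/

section OrderStatistics

variable {N : ℕ}

theorem orderStat_le_iff (z : Fin N → ℝ) {r : ℕ} (h : r - 1 < N) (x : ℝ) :
    orderStat z r ≤ x ↔ r - 1 < (Finset.univ.filter fun i => z i ≤ x).card := by
  have key := Tuple.lt_card_le_iff_apply_le_of_monotone (j := ⟨r - 1, h⟩) (a := x)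
    (Tuple.monotone_sort z)
  have hcard : Finset.card {i | (z ∘ Tuple.sort z) i ≤ x} = Finset.card {i | z i ≤ x} :=
    Finset.card_equiv (Tuple.sort z) fun i => by simp
  rw [hcard] at key
  rw [orderStat, dif_pos h]
  exact key.symm

theorem orderStat_lt_iff (z : Fin N → ℝ) {r : ℕ} (h : r - 1 < N) (x : ℝ) :
    orderStat z r < x ↔ r - 1 < (Finset.univ.filter fun i => z i < x).card := by
  have key := Tuple.lt_card_lt_iff_apply_lt_of_monotone (j := ⟨r - 1, h⟩) (a := x)
    (Tuple.monotone_sort z)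
  have hcard : Finset.card {i | (z ∘ Tuple.sort z) i < x} = Finset.card {i | z i < x} :=
    Finset.card_equiv (Tuple.sort z) fun i => by simp
  rw [hcard] at key
  rw [orderStat, dif_pos h]
  exact key.symm

theorem orderStat_mono (z : Fin N → ℝ) {r s : ℕ} (hrs : r ≤ s) (hs : s - 1 < N) :
    orderStat z r ≤ orderStat z s := by
  rw [orderStat_le_iff z (by omega)]
  have := (orderStat_le_iff z hs _).1 le_rfl
  omega

theorem measurable_orderStat (r : ℕ) : Measurable fun z : Fin N → ℝ => orderStat z r := by
  by_cases h : r - 1 < N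
  · refine measurable_of_Iic fun x => ?_
    have : (fun z : Fin N → ℝ => orderStat z r) ⁻¹' Set.Iic x =
        {z | r - 1 < ∑ i, if z i ≤ x then 1 else 0} := by
      ext z
      simp only [Set.mem_preimage, Set.mem_Iic, Set.mem_ofPred_eq, orderStat_le_iff z h,
        Finset.card_filter]
    rw [this]
    refine measurableSet_lt measurable_const (Finset.measurable_sum _ fun i _ => ?_)
    exact Measurable.ite (measurableSet_le (measurable_pi_apply i) measurable_const)
      measurable_const measurable_const
  · simp only [orderStat, dif_neg h]
    exact measurable_const

theorem sum_ite_eq_card (z : Fin N → ℝ) (p : ℝ → Prop) [DecidablePred p] :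
    (∑ i, if p (z i) then (1 : ℝ) else 0) = (Finset.univ.filter fun i => p (z i)).card := by
  simp

theorem orderStat_ceil_le (z : Fin N → ℝ) {e x : ℝ} (he : 0 < e) (heN : e ≤ N)
    (h : e ≤ ∑ i, if z i ≤ x then (1 : ℝ) else 0) : orderStat z ⌈e⌉₊ ≤ x := by
  have h1 : 0 < ⌈e⌉₊ := Nat.ceil_pos.2 he
  have h2 : ⌈e⌉₊ ≤ N := Nat.ceil_le.2 heN
  rw [sum_ite_eq_card z (· ≤ x)] at h
  have h3 := Nat.ceil_le.2 h
  rw [orderStat_le_iff z (by omega)]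
  omega

theorem le_orderStat_ceil (z : Fin N → ℝ) {e x : ℝ} (he : 0 < e) (heN : e ≤ N)
    (h : (∑ i, if z i < x then (1 : ℝ) else 0) < e) : x ≤ orderStat z ⌈e⌉₊ := by
  have h1 : 0 < ⌈e⌉₊ := Nat.ceil_pos.2 he
  have h2 : ⌈e⌉₊ ≤ N := Nat.ceil_le.2 heN
  rw [sum_ite_eq_card z (· < x)] at h
  have h3 := Nat.lt_ceil.2 h
  rw [← not_lt, orderStat_lt_iff z (by omega)]
  omega

theorem sum_ite_add_sum_ite_not (z : Fin N → ℝ) (p : ℝ → Prop) [DecidablePred p] :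
    (∑ i, if p (z i) then (1 : ℝ) else 0) + (∑ i, if ¬ p (z i) then (1 : ℝ) else 0) = N := by
  rw [← Finset.sum_add_distrib, Finset.sum_congr rfl (g := fun _ => (1 : ℝ))]
  · simp
  · intro i _
    split_ifs <;> simp

theorem orderStat_ceil_sub_le (z : Fin N → ℝ) {e x : ℝ} (he : 0 < e) (heN : e < N)
    (h : (∑ i, if x < z i then (1 : ℝ) else 0) ≤ e) : orderStat z ⌈N - e⌉₊ ≤ x := by
  refine orderStat_ceil_le z (by linarith) (by linarith) ?_
  have := sum_ite_add_sum_ite_not z (· ≤ x)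
  simp only [not_le] at this
  linarith

theorem le_orderStat_ceil_sub (z : Fin N → ℝ) {e x : ℝ} (he : 0 < e) (heN : e < N)
    (h : e < ∑ i, if x ≤ z i then (1 : ℝ) else 0) : x ≤ orderStat z ⌈N - e⌉₊ := by
  refine le_orderStat_ceil z (by linarith) (by linarith) ?_
  have := sum_ite_add_sum_ite_not z (· < x)
  simp only [not_lt] at this
  linarith

end OrderStatistics

theorem truncate_eq {γ β : ℝ} (h : γ ≤ β) (x : ℝ) : truncate γ β x = max γ (min x β) := by
  rw [truncate]
  split_ifs with h1 h2
  · rw [min_eq_right h1.le, max_eq_right h]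
  · rw [min_eq_left (not_lt.1 h1), max_eq_left h2.le]
  · rw [min_eq_left (not_lt.1 h1), max_eq_right (not_lt.1 h2)]

/-- Truncation at random levels is dominated by truncation at upper bounds of these levels. -/
theorem truncate_sub_le {γ β m c K : ℝ} (h : γ ≤ β) (hγ : γ ≤ m + c) (hβ : β ≤ m + K) (x : ℝ) :
    truncate γ β x - m ≤ max c (min (x - m) K) := by
  rw [truncate_eq h, sub_le_iff_le_add, ← max_add_add_right, ← min_add_add_right]
  refine max_le_max (by linarith) (min_le_min (by linarith) (by linarith))

theorem sub_truncate_le {γ β m c K : ℝ} (h : γ ≤ β) (hγ : m - K ≤ γ) (hβ : m - c ≤ β) (x : ℝ) :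
    m - truncate γ β x ≤ max c (min (m - x) K) := by
  rw [truncate_eq h, sub_le_comm, le_max_iff]
  rcases le_total c (min (m - x) K) with hc | hc
  · rw [max_eq_right hc, le_min_iff]
    rcases le_total (m - x) K with hK | hK
    · rw [min_eq_left hK] at hc ⊢
      exact Or.inr ⟨by linarith, by linarith⟩
    · rw [min_eq_right hK]
      exact Or.inl hγ
  · rw [max_eq_left hc, le_min_iff]
    rcases min_le_iff.1 hc with hc | hc
    · exact Or.inr ⟨by linarith, by linarith⟩
    · exact Or.inl (by linarith)

theorem measurable_truncate :
    Measurable fun p : ℝ × ℝ × ℝ => truncate p.1 p.2.1 p.2.2 := by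
  unfold truncate
  refine Measurable.ite (measurableSet_lt (by fun_prop) (by fun_prop)) (by fun_prop) ?_
  exact Measurable.ite (measurableSet_lt (by fun_prop) (by fun_prop)) (by fun_prop) (by fun_prop)

theorem measurable_trimmedMean {M : ℕ} (α δ : ℝ) :
    Measurable fun z : Fin M → ℝ => trimmedMean α δ z := by
  have h1 : Measurable fun z : Fin M → ℝ => firstHalf z :=
    measurable_pi_lambda _ fun i => measurable_pi_apply _
  unfold trimmedMean
  refine Measurable.const_mul (Finset.measurable_sum _ fun i _ => ?_) _
  exact measurable_truncate.comp (((measurable_orderStat _).comp h1).prodMk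
    (((measurable_orderStat _).comp h1).prodMk (measurable_pi_apply _)))

/-! ### The trimmed mean under corruption -/

/-- The positions of the first half of the data set. -/
def firstIndex (M : ℕ) : Fin (M / 2) ↪ Fin M :=
  ⟨fun i => ⟨i, by omega⟩, fun i j h => by simpa [Fin.ext_iff] using h⟩

/-- The positions of the second half of the data set. -/
def secondIndex (M : ℕ) : Fin (M / 2) ↪ Fin M :=
  ⟨fun i => ⟨M / 2 + i, by omega⟩, fun i j h => by simpa [Fin.ext_iff] using h⟩

section Normal

variable {M N : ℕ} (B : Finset (Fin M)) (e : Fin N ↪ Fin M)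

/-- The normal agents among the positions enumerated by `e`. -/
def normal : Finset {i : Fin M // i ∉ B} :=
  (Finset.univ.map e).subtype (· ∉ B)

theorem sum_normal (ψ : Fin M → ℝ) :
    ∑ i ∈ normal B e, ψ i = ∑ j, if e j ∈ B then 0 else ψ (e j) := by
  rw [normal, Finset.sum_subtype_eq_sum_filter, Finset.sum_filter, Finset.sum_map]
  refine Finset.sum_congr rfl fun j _ => ?_
  split_ifs <;> simp_all

theorem sum_byzantine_le {b : ℝ} (hb : 0 ≤ b) :
    ∑ j, (if e j ∈ B then b else 0) ≤ B.card * b := by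
  rw [← Finset.sum_filter, Finset.sum_const, nsmul_eq_mul]
  refine mul_le_mul_of_nonneg_right ?_ hb
  exact_mod_cast Finset.card_le_card_of_injOn e (fun j hj => by simpa using hj)
    e.injective.injOn

theorem sum_le_sum_normal (ψ : Fin M → ℝ) {b : ℝ} (hb : 0 ≤ b) (h : ∀ i, ψ i ≤ b) :
    ∑ j, ψ (e j) ≤ ∑ i ∈ normal B e, ψ i + B.card * b := by
  refine le_trans ?_ (add_le_add_right (sum_byzantine_le B e hb) _)
  rw [sum_normal, ← Finset.sum_add_distrib]
  refine Finset.sum_le_sum fun j _ => ?_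
  have := h (e j)
  split_ifs <;> linarith

theorem sum_normal_le_sum (ψ : Fin M → ℝ) (h : ∀ i, 0 ≤ ψ i) :
    ∑ i ∈ normal B e, ψ i ≤ ∑ j, ψ (e j) := by
  rw [sum_normal]
  refine Finset.sum_le_sum fun j _ => ?_
  have := h (e j)
  split_ifs <;> linarith

theorem card_normal_le : ((normal B e).card : ℝ) ≤ N := by
  simpa using sum_normal_le_sum B e (fun _ => 1) (fun _ => zero_le_one)

theorem le_card_normal : (N : ℝ) ≤ (normal B e).card + B.card := by
  simpa using sum_le_sum_normal B e (fun _ => 1) zero_le_one (fun _ => le_rfl)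

end Normal

/-- The event, expressed through the centred messages `w` of the normal agents, under which the
trimmed mean may overshoot: `s` are the normal agents of the first half, `s'` those of the second
half, `K` bounds the upper truncation level, `c` bounds the lower one, and `e` is the number of
trimmed data on either side. -/
def Overshoot {ι : Type*} (s s' : Finset ι) (e c K : ℝ) (w : ι → ℝ) : Prop :=
  (3 / 4 * e ≤ ∑ i ∈ s, if K < w i then (1 : ℝ) else 0) ∨
    (c < K ∧ (∑ i ∈ s, if w i ≤ c then (1 : ℝ) else 0) ≤ e) ∨
      11 * e * K ≤ ∑ i ∈ s', max c (min (w i) K)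

/-- Outside of the overshoot events of the normal data and of their negatives, no behaviour of the
Byzantine agents can move the trimmed mean away from `m`. -/
theorem abs_trimmedMean_sub_le {M : ℕ} {α δ m K c c' : ℝ} (hM : Even M) (hM0 : 0 < M)
    {B : Finset (Fin M)} (hα : (B.card : ℝ) ≤ α * M) (hlog : 0 < Real.log (4 / δ))
    (hα0 : 0 ≤ α) (hε : trimLevel M α δ ≤ 1 / 2) (hK : 0 < K) (hc : c ≤ K) (hc' : c' ≤ K)
    (z : Fin M → ℝ)
    (hup : ¬ Overshoot (normal B (firstIndex M)) (normal B (secondIndex M))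
      (trimLevel M α δ * (M / 2)) c K (fun i => z i - m))
    (hlo : ¬ Overshoot (normal B (firstIndex M)) (normal B (secondIndex M))
      (trimLevel M α δ * (M / 2)) c' K (fun i => m - z i)) :
    |trimmedMean α δ z - m| ≤ (11 + 1 / 4) * (trimLevel M α δ * K) := by
  set ε := trimLevel M α δ with hεdef
  obtain ⟨N, hN⟩ := hM
  have hN2 : M / 2 = N := by omega
  have hMN : (M : ℝ) / 2 = ((M / 2 : ℕ) : ℝ) := by rw [hN2, hN]; push_cast; ring
  have hMpos : (0 : ℝ) < M := by exact_mod_cast hM0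
  have hε8 : 8 * α < ε := by
    rw [hεdef, trimLevel]
    have : 0 < 24 * (Real.log (4 / δ) / M) := by positivity
    linarith
  have hεpos : 0 < ε := by linarith
  set e := ε * ((M : ℝ) / 2) with he
  have hepos : 0 < e := by positivity
  have heN : e < (M / 2 : ℕ) := by rw [← hMN, he]; nlinarith
  have hBe : (B.card : ℝ) < e / 4 := by rw [he]; nlinarith
  simp only [Overshoot, not_or, not_and, not_le] at hup hlo
  obtain ⟨hu1, hu2, hu3⟩ := hup
  obtain ⟨hl1, hl2, hl3⟩ := hlo
  have hr : (1 - ε) * ((M : ℝ) / 2) = ((M / 2 : ℕ) : ℝ) - e := by rw [← hMN, he]; ring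
  set γ := orderStat (firstHalf z) ⌈e⌉₊ with hγ
  set β := orderStat (firstHalf z) ⌈((M / 2 : ℕ) : ℝ) - e⌉₊ with hβ
  have hfirst : ∀ j, firstHalf z j = z (firstIndex M j) := fun j => rfl
  have hγβ : γ ≤ β := by
    refine orderStat_mono _ (Nat.ceil_le_ceil ?_) ?_
    · rw [← hMN, he]; nlinarith
    · have h1 : ⌈((M / 2 : ℕ) : ℝ) - e⌉₊ ≤ M / 2 := Nat.ceil_le.2 (by linarith)
      have h2 : 0 < ⌈((M / 2 : ℕ) : ℝ) - e⌉₊ := Nat.ceil_pos.2 (by linarith)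
      omega
  -- counting over the whole first half adds at most one unit per Byzantine agent
  have hcount : ∀ p : ℝ → Prop, ∀ _ : DecidablePred p,
      (∑ j, if p (z (firstIndex M j)) then (1 : ℝ) else 0) ≤
        (∑ i ∈ normal B (firstIndex M), if p (z i) then (1 : ℝ) else 0) + B.card := by
    intro p _
    have := sum_le_sum_normal B (firstIndex M) (fun i => if p (z i) then (1 : ℝ) else 0)
      zero_le_one (fun i => by split_ifs <;> norm_num)
    rwa [mul_one] at this
  have hcount' : ∀ p : ℝ → Prop, ∀ _ : DecidablePred p,
      (∑ i ∈ normal B (firstIndex M), if p (z i) then (1 : ℝ) else 0) ≤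
        (∑ j, if p (z (firstIndex M j)) then (1 : ℝ) else 0) := by
    intro p _
    exact sum_normal_le_sum B (firstIndex M) (fun i => if p (z i) then (1 : ℝ) else 0)
      (fun i => by split_ifs <;> norm_num)
  have hβK : β ≤ m + K := by
    refine orderStat_ceil_sub_le _ hepos heN ?_
    simp only [hfirst]
    have h1 := hcount (m + K < ·) inferInstance
    simp only [lt_sub_iff_add_lt'] at hu1
    linarith
  have hγK : m - K ≤ γ := by
    refine le_orderStat_ceil _ hepos heN.le ?_
    simp only [hfirst]
    have h1 := hcount (· < m - K) inferInstance
    simp only [lt_sub_comm (a := K)] at hl1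
    linarith
  have hγc : γ ≤ m + c := by
    rcases hc.lt_or_eq with hcK | rfl
    · refine orderStat_ceil_le _ hepos heN.le ?_
      simp only [hfirst]
      have h1 := hcount' (· ≤ m + c) inferInstance
      have h2 := hu2 hcK
      simp only [sub_le_iff_le_add'] at h2
      linarith
    · exact hγβ.trans hβK
  have hβc : m - c' ≤ β := by
    rcases hc'.lt_or_eq with hcK | rfl
    · refine le_orderStat_ceil_sub _ hepos heN ?_
      simp only [hfirst]
      have h1 := hcount' (m - c' ≤ ·) inferInstance
      have h2 := hl2 hcK
      simp only [sub_le_comm (b := z _)] at h2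
      linarith
    · exact hγK.trans hγβ
  have hmean : trimmedMean α δ z = 2 / (M : ℝ) * ∑ i, truncate γ β (z (secondIndex M i)) := by
    rw [trimmedMean]
    simp only [← hεdef, hr, ← he]
    rfl
  have hsum1 : ∑ j, (truncate γ β (z (secondIndex M j)) - m) ≤ (11 + 1 / 4) * (e * K) := by
    have h1 := sum_le_sum_normal B (secondIndex M) (fun i => truncate γ β (z i) - m) hK.le
      (fun i => (truncate_sub_le hγβ hγc hβK _).trans (max_le hc (min_le_right _ _)))
    have h2 := Finset.sum_le_sum fun i (_ : i ∈ normal B (secondIndex M)) =>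
      truncate_sub_le hγβ hγc hβK (z i)
    nlinarith
  have hsum2 : ∑ j, (m - truncate γ β (z (secondIndex M j))) ≤ (11 + 1 / 4) * (e * K) := by
    have h1 := sum_le_sum_normal B (secondIndex M) (fun i => m - truncate γ β (z i)) hK.le
      (fun i => (sub_truncate_le hγβ hγK hβc _).trans (max_le hc' (min_le_right _ _)))
    have h2 := Finset.sum_le_sum fun i (_ : i ∈ normal B (secondIndex M)) =>
      sub_truncate_le hγβ hγK hβc (z i)
    nlinarith
  rw [Finset.sum_sub_distrib, Finset.sum_const, Finset.card_univ, Fintype.card_fin, nsmul_eq_mul,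
    ← hMN] at hsum1 hsum2
  have hscale : ∀ S : ℝ, 2 / (M : ℝ) * S - m = (S - M / 2 * m) / (M / 2) := by
    intro S
    field_simp
  have hscale' : (11 + 1 / 4) * (ε * K) = (11 + 1 / 4) * (e * K) / (M / 2) := by
    rw [he]
    field_simp
  rw [hmean, hscale, hscale', abs_div, abs_of_pos (show (0 : ℝ) < M / 2 by positivity)]
  gcongr
  rw [abs_le]
  constructor <;> linarith

/-! ### A Bernstein bound for product measures -/

section Bernstein

variable {ι Ξ : Type*} [Fintype ι] [MeasurableSpace Ξ] {ν : Measure Ξ} [IsProbabilityMeasure ν]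

theorem integrable_of_abs_le_one {F : Ξ → ℝ} (hF : Measurable F) (hb : ∀ x, |F x| ≤ 1) :
    Integrable F ν :=
  Integrable.of_bound hF.aestronglyMeasurable 1 (ae_of_all _ hb)

theorem integral_exp_le {F : Ξ → ℝ} (hF : Measurable F) (hb : ∀ x, |F x| ≤ 1) {a : ℝ}
    (ha : ∫ x, F x ∂ν + ∫ x, F x ^ 2 ∂ν ≤ a) : ∫ x, Real.exp (F x) ∂ν ≤ Real.exp a := by
  have h1 := integrable_of_abs_le_one (ν := ν) hF hb
  have h2 : Integrable (fun x => F x ^ 2) ν :=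
    integrable_of_abs_le_one (hF.pow_const 2) fun x => by
      rw [abs_of_nonneg (sq_nonneg _), sq_le_one_iff_abs_le_one]
      exact hb x
  have h12 : Integrable (fun x => 1 + F x) ν := (integrable_const 1).add h1
  have h3 : Integrable (fun x => Real.exp (F x)) ν :=
    Integrable.of_bound (Real.measurable_exp.comp hF).aestronglyMeasurable (Real.exp 1)
      (ae_of_all _ fun x => by
        rw [Real.norm_eq_abs, Real.abs_exp]
        exact Real.exp_le_exp.2 (le_of_abs_le (hb x)))
  calc ∫ x, Real.exp (F x) ∂ν ≤ ∫ x, (1 + F x + F x ^ 2) ∂ν := by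
        refine integral_mono h3 (h12.add h2) fun x => ?_
        have := le_of_abs_le (Real.abs_exp_sub_one_sub_id_le (hb x))
        dsimp only
        linarith
    _ = 1 + (∫ x, F x ∂ν + ∫ x, F x ^ 2 ∂ν) := by
        rw [integral_add h12 h2, integral_add (integrable_const 1) h1]
        simp [add_assoc]
    _ ≤ 1 + a := by linarith
    _ ≤ Real.exp a := by linarith [Real.add_one_le_exp a]

/-- Chernoff's method with `exp F ≤ 1 + F + F ^ 2` for `|F| ≤ 1`. -/
theorem measureReal_pi_le_exp {F : Ξ → ℝ} (hF : Measurable F) (hb : ∀ x, |F x| ≤ 1) {a : ℝ}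
    (ha : ∫ x, F x ∂ν + ∫ x, F x ^ 2 ∂ν ≤ a) (s : Finset ι) (t : ℝ) :
    (Measure.pi fun _ : ι => ν).real {x | t ≤ ∑ i ∈ s, F (x i)} ≤ Real.exp (s.card * a - t) := by
  classical
  have hmeas : Measurable fun x : ι → Ξ => ∑ i ∈ s, F (x i) :=
    Finset.measurable_sum _ fun i _ => hF.comp (measurable_pi_apply i)
  have hint : Integrable (fun x : ι → Ξ => Real.exp (1 * ∑ i ∈ s, F (x i)))
      (Measure.pi fun _ : ι => ν) := by
    refine Integrable.of_bound
      (Real.measurable_exp.comp (hmeas.const_mul 1)).aestronglyMeasurable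
      (Real.exp s.card) (ae_of_all _ fun x => ?_)
    rw [Real.norm_eq_abs, Real.abs_exp, one_mul, Real.exp_le_exp]
    calc ∑ i ∈ s, F (x i) ≤ ∑ i ∈ s, (1 : ℝ) := Finset.sum_le_sum fun i _ => le_of_abs_le (hb _)
      _ = s.card := by simp
  refine (measure_ge_le_exp_mul_mgf t zero_le_one hint).trans ?_
  have hprod : mgf (fun x : ι → Ξ => ∑ i ∈ s, F (x i)) (Measure.pi fun _ : ι => ν) 1 =
      ∏ i : ι, ∫ x, (if i ∈ s then Real.exp (F x) else 1) ∂ν := by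
    rw [mgf, ← integral_fintype_prod_eq_prod]
    congr 1 with x
    simp only [one_mul]
    rw [Real.exp_sum, Finset.prod_ite_mem, Finset.univ_inter]
  have hpow : ∏ i : ι, ∫ x, (if i ∈ s then Real.exp (F x) else 1) ∂ν ≤
      Real.exp a ^ s.card := by
    have : ∀ i : ι, ∫ x, (if i ∈ s then Real.exp (F x) else 1) ∂ν =
        if i ∈ s then ∫ x, Real.exp (F x) ∂ν else 1 := by
      intro i
      split_ifs <;> simp
    simp only [this]
    rw [Finset.prod_ite_mem, Finset.univ_inter, Finset.prod_const]
    exact pow_le_pow_left₀ (integral_nonneg fun x => (Real.exp_pos _).le)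
      (integral_exp_le hF hb ha) _
  calc Real.exp (-1 * t) * mgf (fun x : ι → Ξ => ∑ i ∈ s, F (x i)) (Measure.pi fun _ : ι => ν) 1
      ≤ Real.exp (-1 * t) * Real.exp a ^ s.card := by
        rw [hprod]
        exact mul_le_mul_of_nonneg_left hpow (Real.exp_pos _).le
    _ = Real.exp (s.card * a - t) := by
        rw [← Real.exp_nat_mul, ← Real.exp_add]
        ring_nf

end Bernstein

/-! ### Capped quantiles -/

/-- The lower `p`-quantile of `ν`, confined to the interval `[-K, K]`. It equals `K` when no
`t < K` has mass at least `p` to its left, in particular when `p > 1`. -/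
noncomputable def cappedQuantile (ν : Measure ℝ) (p K : ℝ) : ℝ :=
  sInf {t | -K ≤ t ∧ (t = K ∨ (t < K ∧ p ≤ ν.real (Set.Iic t)))}

section CappedQuantile

variable {ν : Measure ℝ} {p K : ℝ}

theorem bddBelow_cappedQuantile :
    BddBelow {t | -K ≤ t ∧ (t = K ∨ (t < K ∧ p ≤ ν.real (Set.Iic t)))} :=
  ⟨-K, fun _ ht => ht.1⟩

theorem neg_le_cappedQuantile (hK : 0 < K) : -K ≤ cappedQuantile ν p K :=
  le_csInf ⟨K, by linarith, Or.inl rfl⟩ fun _ ht => ht.1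

theorem cappedQuantile_le (hK : 0 < K) : cappedQuantile ν p K ≤ K :=
  csInf_le bddBelow_cappedQuantile ⟨by linarith, Or.inl rfl⟩

variable [IsProbabilityMeasure ν]

theorem le_measureReal_Iic_cappedQuantile (h : cappedQuantile ν p K < K) (hK : 0 < K) :
    p ≤ ν.real (Set.Iic (cappedQuantile ν p K)) := by
  rw [← cdf_eq_real]
  have hcont : Filter.Tendsto (cdf ν) (nhdsWithin (cappedQuantile ν p K) (Set.Ioi _))
      (nhds (cdf ν (cappedQuantile ν p K))) :=
    ((cdf ν).right_continuous _).mono Set.Ioi_subset_Ici_self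
  refine ge_of_tendsto hcont ?_
  filter_upwards [Ioo_mem_nhdsGT h] with t ht
  obtain ⟨t', ⟨-, ht'⟩, hlt⟩ := (csInf_lt_iff bddBelow_cappedQuantile
    ⟨K, by linarith, Or.inl rfl⟩).1 ht.1
  rcases ht' with rfl | ⟨-, hp⟩
  · exact absurd hlt ht.2.not_gt
  · rw [← cdf_eq_real] at hp
    exact hp.trans ((cdf ν).mono hlt.le)

theorem measureReal_Iio_cappedQuantile_le (hK : 0 < K) (hp : ν.real (Set.Iio (-K)) ≤ p) :
    ν.real (Set.Iio (cappedQuantile ν p K)) ≤ p := by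
  rcases (neg_le_cappedQuantile (ν := ν) (p := p) hK).eq_or_lt with h | h
  · rwa [← h]
  obtain ⟨u, hu, hlt, hlim⟩ := exists_seq_strictMono_tendsto' h
  have hunion : Set.Iio (cappedQuantile ν p K) = ⋃ k, Set.Iic (u k) := by
    ext x
    simp only [Set.mem_Iio, Set.mem_iUnion, Set.mem_Iic]
    refine ⟨fun hx => ?_, fun ⟨k, hk⟩ => hk.trans_lt (hlt k).2⟩
    obtain ⟨k, hk⟩ := (hlim.eventually (lt_mem_nhds hx)).exists
    exact ⟨k, hk.le⟩
  have htends := tendsto_measure_iUnion_atTop (μ := ν) (s := fun k => Set.Iic (u k))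
    fun i j hij => Set.Iic_subset_Iic.2 (hu.monotone hij)
  rw [← hunion] at htends
  refine le_of_tendsto' ((ENNReal.tendsto_toReal (measure_ne_top _ _)).comp htends) fun k => ?_
  by_contra! hk
  refine (hlt k).2.not_ge (csInf_le bddBelow_cappedQuantile ⟨(hlt k).1.le, Or.inr ⟨?_, hk.le⟩⟩)
  exact (hlt k).2.trans_le (cappedQuantile_le hK)

theorem cappedQuantile_le_iff (hK : 0 < K) (t : ℝ) :
    cappedQuantile ν p K ≤ t ↔ K ≤ t ∨ (-K ≤ t ∧ p ≤ ν.real (Set.Iic t)) := by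
  constructor
  · intro h
    rcases (cappedQuantile_le (ν := ν) (p := p) hK).eq_or_lt with hq | hq
    · exact Or.inl (hq ▸ h)
    · refine Or.inr ⟨(neg_le_cappedQuantile hK).trans h, ?_⟩
      exact (le_measureReal_Iic_cappedQuantile hq hK).trans
        (measureReal_mono (Set.Iic_subset_Iic.2 h))
  · intro h
    by_cases hKt : K ≤ t
    · exact (cappedQuantile_le hK).trans hKt
    · have h' := h.resolve_left hKt
      exact csInf_le bddBelow_cappedQuantile ⟨h'.1, Or.inr ⟨not_le.1 hKt, h'.2⟩⟩

end CappedQuantile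

theorem measurable_cappedQuantile {U Ξ : Type*} [MeasurableSpace U] [MeasurableSpace Ξ]
    (ν : Measure Ξ) [IsProbabilityMeasure ν] {X : U → Ξ → ℝ} (hX : Measurable (Function.uncurry X))
    {K : ℝ} (hK : 0 < K) (p : ℝ) : Measurable fun u => cappedQuantile (ν.map (X u)) p K := by
  have hXu : ∀ u, Measurable (X u) := fun u => hX.comp measurable_prodMk_left
  refine measurable_of_Iic fun t => ?_
  have : (fun u => cappedQuantile (ν.map (X u)) p K) ⁻¹' Set.Iic t =
      {u | K ≤ t ∨ (-K ≤ t ∧ p ≤ ν.real (Prod.mk u ⁻¹' {q | Function.uncurry X q ≤ t}))} := by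
    ext u
    have := Measure.isProbabilityMeasure_map (μ := ν) (hXu u).aemeasurable
    rw [Set.mem_preimage, Set.mem_Iic, cappedQuantile_le_iff hK,
      map_measureReal_apply (hXu u) measurableSet_Iic]
    rfl
  rw [this]
  have hmeas : Measurable fun u => ν.real (Prod.mk u ⁻¹' {q | Function.uncurry X q ≤ t}) :=
    (measurable_measure_prodMk_left (measurableSet_le hX measurable_const)).ennreal_toReal
  exact (MeasurableSet.const _).union ((MeasurableSet.const _).inter
    (measurableSet_le measurable_const hmeas))

/-! ### The probability of an overshoot -/

section Overshoot

variable {ι Ξ : Type*} [MeasurableSpace Ξ]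

theorem measurableSet_overshoot {U : Type*} [MeasurableSpace U] {X : U → Ξ → ℝ}
    (hX : Measurable (Function.uncurry X)) {c : U → ℝ} (hc : Measurable c) (s s' : Finset ι)
    (e K : ℝ) :
    MeasurableSet {q : U × (ι → Ξ) | Overshoot s s' e (c q.1) K fun i => X q.1 (q.2 i)} := by
  have hXi : ∀ i, Measurable fun q : U × (ι → Ξ) => X q.1 (q.2 i) := fun i =>
    hX.comp (measurable_fst.prodMk ((measurable_pi_apply i).comp measurable_snd))
  have hc' : Measurable fun q : U × (ι → Ξ) => c q.1 := hc.comp measurable_fst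
  have h1 : MeasurableSet {q : U × (ι → Ξ) |
      3 / 4 * e ≤ ∑ i ∈ s, if K < X q.1 (q.2 i) then (1 : ℝ) else 0} :=
    measurableSet_le measurable_const (Finset.measurable_sum _ fun i _ =>
      Measurable.ite (measurableSet_lt measurable_const (hXi i)) measurable_const measurable_const)
  have h2 : MeasurableSet {q : U × (ι → Ξ) | c q.1 < K} := measurableSet_lt hc' measurable_const
  have h3 : MeasurableSet {q : U × (ι → Ξ) |
      (∑ i ∈ s, if X q.1 (q.2 i) ≤ c q.1 then (1 : ℝ) else 0) ≤ e} :=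
    measurableSet_le (Finset.measurable_sum _ fun i _ =>
      Measurable.ite (measurableSet_le (hXi i) hc') measurable_const measurable_const)
      measurable_const
  have h4 : MeasurableSet {q : U × (ι → Ξ) |
      11 * e * K ≤ ∑ i ∈ s', max (c q.1) (min (X q.1 (q.2 i)) K)} :=
    measurableSet_le measurable_const (Finset.measurable_sum _ fun i _ =>
      hc'.max ((hXi i).min measurable_const))
  exact h1.union ((h2.inter h3).union h4)

variable {ν : Measure Ξ} {X : Ξ → ℝ} {ε K N : ℝ}

theorem measureReal_le_of_integral_sq_le [IsFiniteMeasure ν]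
    (hX2 : Integrable (fun x => X x ^ 2) ν) (hK : 0 < K)
    (hvar : ∫ x, X x ^ 2 ∂ν ≤ ε / 4 * K ^ 2) {s : Set Ξ} (hs : ∀ x ∈ s, K ≤ |X x|) :
    ν.real s ≤ ε / 4 := by
  have h1 := mul_meas_ge_le_integral_of_nonneg (μ := ν)
    (ae_of_all _ fun x => sq_nonneg (X x)) hX2 (K ^ 2)
  have h2 : ν.real s ≤ ν.real {x | K ^ 2 ≤ X x ^ 2} :=
    measureReal_mono fun x hx => by
      rw [Set.mem_ofPred_eq, ← sq_abs (X x)]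
      exact pow_le_pow_left₀ hK.le (hs x hx) 2
  have h3 : 0 < K ^ 2 := by positivity
  have h4 : K ^ 2 * ν.real s ≤ K ^ 2 * (ε / 4) := by nlinarith
  exact le_of_mul_le_mul_left h4 h3

theorem integral_ite_one {p : Ξ → Prop} [DecidablePred p] (hp : MeasurableSet {x | p x}) (a : ℝ) :
    ∫ x, (if p x then a else 0) ∂ν = ν.real {x | p x} * a := by
  have := integral_indicator_const (μ := ν) a hp
  rw [smul_eq_mul] at this
  rw [← this]
  congr 1 with x
  simp [Set.indicator]

variable [Fintype ι] [IsProbabilityMeasure ν]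

/-- For centred data of variance at most `ε / 4 * K ^ 2`, with the lower `4 ε`-quantile as the bound
on the lower truncation level. -/
theorem measureReal_overshoot_le (hX : Measurable X) (hX1 : Integrable X ν)
    (hX2 : Integrable (fun x => X x ^ 2) ν) (hmean : ∫ x, X x ∂ν = 0) (hK : 0 < K) (hε : 0 < ε)
    (hN : 0 ≤ N) (hvar : ∫ x, X x ^ 2 ∂ν ≤ ε / 4 * K ^ 2) {s s' : Finset ι}
    (hs : 3 / 4 * N ≤ s.card) (hsN : (s.card : ℝ) ≤ N) (hs' : (s'.card : ℝ) ≤ N) :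
    (Measure.pi fun _ : ι => ν).real {x | Overshoot s s' (ε * N)
      (cappedQuantile (ν.map X) (4 * ε) K) K fun i => X (x i)} ≤
      3 * Real.exp (-(ε * N / 4)) := by
  have := Measure.isProbabilityMeasure_map (μ := ν) hX.aemeasurable
  set c := cappedQuantile (ν.map X) (4 * ε) K with hcdef
  have hc1 : -K ≤ c := neg_le_cappedQuantile hK
  have hc2 : c ≤ K := cappedQuantile_le hK
  have hcheb := fun s => measureReal_le_of_integral_sq_le (s := s) hX2 hK hvar
  have hA : ν.real {x | X x < c} ≤ 4 * ε := by
    have h1 := measureReal_Iio_cappedQuantile_le (ν := ν.map X) (p := 4 * ε) hK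
    rw [map_measureReal_apply hX measurableSet_Iio,
      map_measureReal_apply hX measurableSet_Iio] at h1
    refine h1 ((hcheb _ fun x hx => ?_).trans (by linarith))
    rw [Set.mem_preimage, Set.mem_Iio] at hx
    exact le_trans (by linarith) (neg_le_abs (X x))
  have hle : ∀ x y : ℝ, x ≤ y → Real.exp x ≤ Real.exp y := fun _ _ => Real.exp_le_exp.2
  have hεN : 0 ≤ ε * N := by positivity
  -- few normal agents of the first half exceed `K`
  have b1 : (Measure.pi fun _ : ι => ν).real
      {x | 3 / 4 * (ε * N) ≤ ∑ i ∈ s, if K < X (x i) then (1 : ℝ) else 0} ≤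
      Real.exp (-(ε * N / 4)) := by
    have hm : MeasurableSet {x | K < X x} := measurableSet_lt measurable_const hX
    have hp : ν.real {x | K < X x} ≤ ε / 4 := hcheb _ fun x hx => hx.le.trans (le_abs_self _)
    refine (measureReal_pi_le_exp (F := fun x => if K < X x then (1 : ℝ) else 0) (a := ε / 2)
      (Measurable.ite hm measurable_const measurable_const)
      (fun x => by split_ifs <;> norm_num) ?_ s _).trans (hle _ _ ?_)
    · simp only [ite_pow, one_pow, zero_pow two_ne_zero]
      rw [integral_ite_one hm]
      linarith
    · nlinarith
  -- many of them lie below the quantile; if it is capped at `K`, the event is void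
  have b2 : (Measure.pi fun _ : ι => ν).real
      {x | c < K ∧ (∑ i ∈ s, if X (x i) ≤ c then (1 : ℝ) else 0) ≤ ε * N} ≤
      Real.exp (-(ε * N / 4)) := by
    by_cases hcK : c < K
    swap
    · simp only [hcK, false_and, Set.ofPred_false, measureReal_empty]
      positivity
    have hm : MeasurableSet {x | X x ≤ c} := measurableSet_le hX measurable_const
    have hp : 4 * ε ≤ ν.real {x | X x ≤ c} := by
      have h1 := le_measureReal_Iic_cappedQuantile hcK hK
      rwa [map_measureReal_apply hX measurableSet_Iic] at h1
    refine le_trans (measureReal_mono fun x hx => ?_)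
      ((measureReal_pi_le_exp (F := fun x => if X x ≤ c then (-(1 / 2) : ℝ) else 0) (a := -ε)
      (Measurable.ite hm measurable_const measurable_const)
      (fun x => by split_ifs <;> norm_num [abs_le]) ?_ s (-(1 / 2) * (ε * N))).trans (hle _ _ ?_))
    · have h1 : ∑ i ∈ s, (if X (x i) ≤ c then (-(1 / 2) : ℝ) else 0) =
          -(1 / 2) * ∑ i ∈ s, (if X (x i) ≤ c then (1 : ℝ) else 0) := by
        rw [Finset.mul_sum]
        refine Finset.sum_congr rfl fun i _ => ?_
        split_ifs <;> simp
      rw [Set.mem_ofPred_eq, h1]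
      linarith [hx.2]
    · simp only [ite_pow, zero_pow two_ne_zero]
      rw [integral_ite_one hm, integral_ite_one hm]
      linarith
    · nlinarith
  -- the truncated data of the second half have a small mean and a small second moment
  have b3 : (Measure.pi fun _ : ι => ν).real
      {x | 11 * (ε * N) * K ≤ ∑ i ∈ s', max c (min (X (x i)) K)} ≤
      Real.exp (-(ε * N / 4)) := by
    have hm : MeasurableSet {x | X x < c} := measurableSet_lt hX measurable_const
    set F : Ξ → ℝ := fun x => max c (min (X x) K) / K with hF
    have hFm : Measurable F := (measurable_const.max (hX.min measurable_const)).div_const K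
    have hFb : ∀ x, |F x| ≤ 1 := fun x => by
      rw [hF, abs_div, abs_of_pos hK, div_le_one hK, abs_le]
      exact ⟨hc1.trans (le_max_left _ _), max_le hc2 (min_le_right _ _)⟩
    have hind : Integrable (fun x => if X x < c then (1 : ℝ) else 0) ν :=
      integrable_of_abs_le_one (Measurable.ite hm measurable_const measurable_const)
        (fun x => by split_ifs <;> norm_num)
    have hF1 : ∀ x, F x ≤ X x / K + 3 / 2 * (if X x < c then (1 : ℝ) else 0) +
        1 / (2 * K ^ 2) * X x ^ 2 := by
      intro x
      have e1 : X x / K + 3 / 2 * (if X x < c then (1 : ℝ) else 0) + 1 / (2 * K ^ 2) * X x ^ 2 =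
          (X x + 3 / 2 * K * (if X x < c then (1 : ℝ) else 0) + X x ^ 2 / (2 * K)) / K := by
        field_simp
      rw [e1, hF]
      refine div_le_div_of_nonneg_right ?_ hK.le
      have h0 : 0 ≤ X x ^ 2 / (2 * K) := by positivity
      split_ifs with h
      · have h2 : -X x ≤ K / 2 + X x ^ 2 / (2 * K) := by
          have : K / 2 + X x ^ 2 / (2 * K) + X x = (K + X x) ^ 2 / (2 * K) := by
            field_simp
            ring
          have : 0 ≤ (K + X x) ^ 2 / (2 * K) := by positivity
          linarith
        refine max_le (by linarith) ((min_le_left _ _).trans ?_)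
        linarith
      · refine max_le (by linarith [not_lt.1 h]) ((min_le_left _ _).trans ?_)
        linarith
    have hF2 : ∀ x, F x ^ 2 ≤ 1 / K ^ 2 * X x ^ 2 + (if X x < c then (1 : ℝ) else 0) := by
      intro x
      split_ifs with h
      · have h1 : F x ^ 2 ≤ 1 := (sq_le_one_iff_abs_le_one _).2 (hFb x)
        have h2 : 0 ≤ 1 / K ^ 2 * X x ^ 2 := by positivity
        linarith
      · have h1 : F x = min (X x) K / K := by
          rw [hF]
          dsimp only
          rw [max_eq_right (le_min (not_lt.1 h) hc2)]
        rw [h1, div_pow, add_zero, one_div, inv_mul_eq_div]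
        refine div_le_div_of_nonneg_right ?_ (by positivity)
        rcases le_total (X x) K with h2 | h2
        · rw [min_eq_left h2]
        · rw [min_eq_right h2]
          exact pow_le_pow_left₀ hK.le h2 2
    have hX1ind : Integrable
        (fun x => X x / K + 3 / 2 * (if X x < c then (1 : ℝ) else 0)) ν :=
      (hX1.div_const K).add (hind.const_mul _)
    have hv : 1 / K ^ 2 * ∫ x, X x ^ 2 ∂ν ≤ ε / 4 := by
      rw [one_div, inv_mul_le_iff₀ (by positivity)]
      linarith
    have hI1 : ∫ x, F x ∂ν ≤ 6 * ε + ε / 8 := by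
      calc ∫ x, F x ∂ν ≤ ∫ x, (X x / K + 3 / 2 * (if X x < c then (1 : ℝ) else 0) +
            1 / (2 * K ^ 2) * X x ^ 2) ∂ν :=
            integral_mono (integrable_of_abs_le_one hFm hFb)
              (hX1ind.add (hX2.const_mul _)) hF1
        _ = 3 / 2 * ν.real {x | X x < c} + 1 / 2 * (1 / K ^ 2 * ∫ x, X x ^ 2 ∂ν) := by
            rw [integral_add hX1ind (hX2.const_mul _),
              integral_add (hX1.div_const K) (hind.const_mul _), integral_div, hmean,
              integral_const_mul, integral_const_mul, integral_ite_one hm]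
            ring
        _ ≤ 6 * ε + ε / 8 := by linarith
    have hI2 : ∫ x, F x ^ 2 ∂ν ≤ ε / 4 + 4 * ε := by
      calc ∫ x, F x ^ 2 ∂ν ≤ ∫ x, (1 / K ^ 2 * X x ^ 2 + (if X x < c then (1 : ℝ) else 0)) ∂ν :=
            integral_mono (integrable_of_abs_le_one (hFm.pow_const 2) fun x => by
              rw [abs_of_nonneg (sq_nonneg _), sq_le_one_iff_abs_le_one]
              exact hFb x) ((hX2.const_mul _).add hind) hF2
        _ = 1 / K ^ 2 * ∫ x, X x ^ 2 ∂ν + ν.real {x | X x < c} := by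
            rw [integral_add (hX2.const_mul _) hind, integral_const_mul, integral_ite_one hm,
              mul_one]
        _ ≤ ε / 4 + 4 * ε := by linarith
    refine le_trans (measureReal_mono fun x hx => ?_)
      ((measureReal_pi_le_exp (a := 21 / 2 * ε) hFm hFb (by linarith) s'
        (11 * (ε * N))).trans (hle _ _ ?_))
    · rw [Set.mem_ofPred_eq, hF, ← Finset.sum_div, le_div_iff₀ hK]
      exact hx
    · nlinarith
  calc (Measure.pi fun _ : ι => ν).real {x | Overshoot s s' (ε * N) c K fun i => X (x i)}
      ≤ _ := measureReal_union_le _ _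
    _ ≤ Real.exp (-(ε * N / 4)) + (Real.exp (-(ε * N / 4)) + Real.exp (-(ε * N / 4))) :=
        add_le_add b1 ((measureReal_union_le _ _).trans (add_le_add b2 b3))
    _ = 3 * Real.exp (-(ε * N / 4)) := by ring

end Overshoot

/-! ### The trimmed mean at a random query point -/

section Stage

variable {U Ξ Ω : Type*} [mU : MeasurableSpace U] [MeasurableSpace Ξ] {m' : MeasurableSpace Ω}
  [mΩ : MeasurableSpace Ω]
  {μ : Measure Ω} [IsProbabilityMeasure μ] {𝒟 : Measure Ξ} [IsProbabilityMeasure 𝒟]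

/-- A bound for the samples at every fixed query point carries over to a query point that is
independent of the samples. -/
theorem measureReal_query_le {ι : Type*} [Fintype ι] (hm' : m' ≤ mΩ)
    {u : Ω → U} (hu : Measurable[m'] u) {ξ : ι → Ω → Ξ} (hξ : ∀ i, Measurable (ξ i))
    (hlaw : ∀ i, μ.map (ξ i) = 𝒟) (hindep : iIndepFun ξ μ)
    (hpast : Indep (MeasurableSpace.comap (fun ω i => ξ i ω) inferInstance) m' μ)
    {A : Set (U × (ι → Ξ))} (hA : MeasurableSet A) {p : ℝ}
    (h : ∀ ω, (Measure.pi fun _ : ι => 𝒟).real {x | (u ω, x) ∈ A} ≤ p) :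
    μ.real {ω | (u ω, fun i => ξ i ω) ∈ A} ≤ p := by
  have hp : 0 ≤ p := by
    obtain ⟨ω⟩ := nonempty_of_isProbabilityMeasure μ
    exact measureReal_nonneg.trans (h ω)
  have hu' : Measurable u := hu.mono hm' le_rfl
  have hξ' : Measurable fun ω i => ξ i ω := measurable_pi_lambda _ hξ
  have hind : IndepFun u (fun ω i => ξ i ω) μ :=
    indep_of_indep_of_le_right hpast.symm le_rfl |> fun h' =>
      (IndepFun_iff_Indep _ _ _).2 (indep_of_indep_of_le_left h' hu.comap_le)
  have hmap := (indepFun_iff_map_prod_eq_prod_map_map hu'.aemeasurable hξ'.aemeasurable).1 hind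
  rw [(iIndepFun_iff_map_fun_eq_pi_map fun i => (hξ i).aemeasurable).1 hindep] at hmap
  simp only [hlaw] at hmap
  refine ENNReal.toReal_le_of_le_ofReal hp ?_
  have h1 : μ {ω | (u ω, fun i => ξ i ω) ∈ A} = μ.map (fun ω => (u ω, fun i => ξ i ω)) A :=
    (Measure.map_apply (hu'.prodMk hξ') hA).symm
  rw [h1, hmap, Measure.prod_apply hA, lintegral_map (measurable_measure_prodMk_left hA) hu']
  calc ∫⁻ ω, (Measure.pi fun _ : ι => 𝒟) (Prod.mk (u ω) ⁻¹' A) ∂μ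
      ≤ ∫⁻ _, ENNReal.ofReal p ∂μ := lintegral_mono fun ω => by
        rw [ENNReal.le_ofReal_iff_toReal_le (measure_ne_top _ _) hp]
        exact h ω
    _ = ENNReal.ofReal p := by simp

variable {M : ℕ} {B : Finset (Fin M)} {α δ : ℝ}

theorem six_mul_exp_trimLevel_le (hM0 : 0 < M) (hα0 : 0 ≤ α) (hδ0 : 0 < δ) (hδ1 : δ ≤ 1) :
    6 * Real.exp (-(trimLevel M α δ * ((M : ℝ) / 2) / 4)) ≤ δ := by
  have hMpos : (0 : ℝ) < M := by exact_mod_cast hM0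
  have h1 : 3 * Real.log (4 / δ) ≤ trimLevel M α δ * ((M : ℝ) / 2) / 4 := by
    have h2 : trimLevel M α δ * ((M : ℝ) / 2) / 4 = α * M + 3 * Real.log (4 / δ) := by
      rw [trimLevel]
      field_simp
      ring
    rw [h2]
    linarith [mul_nonneg hα0 hMpos.le]
  have h3 : Real.exp (-(3 * Real.log (4 / δ))) = (δ / 4) ^ 3 := by
    rw [← mul_neg, ← Real.log_inv, inv_div]
    have := Real.exp_nat_mul (Real.log (δ / 4)) 3
    rw [Real.exp_log (by positivity)] at this
    exact_mod_cast this
  calc 6 * Real.exp (-(trimLevel M α δ * ((M : ℝ) / 2) / 4))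
      ≤ 6 * (δ / 4) ^ 3 := by
        rw [← h3]
        gcongr
    _ ≤ δ := by nlinarith [mul_nonneg hδ0.le hδ0.le, mul_nonneg (mul_nonneg hδ0.le hδ0.le) hδ0.le]

theorem measureReal_trimmedMean_of_pos (hM : Even M) (hM0 : 0 < M)
    (hB : (B.card : ℝ) ≤ α * M) (hα0 : 0 ≤ α) (hα1 : α < 1 / 16) (hδ0 : 0 < δ) (hδ1 : δ ≤ 1)
    (hε : trimLevel M α δ ≤ 1 / 2) (hm' : m' ≤ mΩ)
    {u : Ω → U} (hu : Measurable[m'] u) {ξ : Fin M → Ω → Ξ} (hξ : ∀ i ∉ B, Measurable (ξ i))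
    (hlaw : ∀ i ∉ B, μ.map (ξ i) = 𝒟) (hindep : iIndepFun (fun i : {i // i ∉ B} => ξ i) μ)
    (hpast : Indep (MeasurableSpace.comap (fun ω (i : {i // i ∉ B}) => ξ i ω) inferInstance) m' μ)
    {h : U → Ξ → ℝ} (hh : Measurable (Function.uncurry h)) {G : U → ℝ} {τ : ℝ} (hτ : 0 < τ)
    (hint : ∀ ω, Integrable (h (u ω)) 𝒟) (hmean : ∀ ω, ∫ x, h (u ω) x ∂𝒟 = G (u ω))
    (hint2 : ∀ ω, Integrable (fun x => (h (u ω) x - G (u ω)) ^ 2) 𝒟)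
    (hvar : ∀ ω, ∫ x, (h (u ω) x - G (u ω)) ^ 2 ∂𝒟 ≤ τ ^ 2)
    {z : Ω → Fin M → ℝ} (hz : ∀ ω, ∀ i ∉ B, z ω i = h (u ω) (ξ i ω)) :
    μ.real {ω | 23 * (τ * Real.sqrt (trimLevel M α δ)) <
      |trimmedMean α δ (z ω) - G (u ω)|} ≤ δ := by
  set ε := trimLevel M α δ with hεdef
  have hMpos : (0 : ℝ) < M := by exact_mod_cast hM0
  have hlog : 0 < Real.log (4 / δ) := Real.log_pos (by rw [lt_div_iff₀ hδ0]; linarith)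
  have hεpos : 0 < ε := by rw [hεdef, trimLevel]; positivity
  have hsq : 0 < Real.sqrt ε := Real.sqrt_pos.2 hεpos
  -- by Chebyshev, the data exceed `K` with probability at most `ε / 4`
  set K := 2 * τ / Real.sqrt ε with hKdef
  have hK : 0 < K := by positivity
  have hK2 : ε / 4 * K ^ 2 = τ ^ 2 := by
    rw [hKdef, div_pow, Real.sq_sqrt hεpos.le]
    field_simp
    ring
  have hεK : ε * K = 2 * (τ * Real.sqrt ε) := by
    rw [hKdef]
    field_simp
    rw [Real.sq_sqrt hεpos.le]
  set X : U → Ξ → ℝ := fun v x => h v x - ∫ x', h v x' ∂𝒟 with hXdef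
  have hX : Measurable (Function.uncurry X) :=
    hh.sub ((hh.stronglyMeasurable.integral_prod_right (ν := 𝒟)).measurable.comp measurable_fst)
  have hX' : Measurable (Function.uncurry fun v x => -X v x) := hX.neg
  have hXG : ∀ ω, X (u ω) = fun x => h (u ω) x - G (u ω) := fun ω => by
    rw [hXdef]
    simp only [hmean ω]
  have hX0 : ∀ ω, ∫ x, X (u ω) x ∂𝒟 = 0 := fun ω => by
    rw [hXG, integral_sub (hint ω) (integrable_const _), hmean]
    simp
  have hX1 : ∀ ω, Integrable (X (u ω)) 𝒟 := fun ω => by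
    rw [hXG]
    exact (hint ω).sub (integrable_const _)
  set s := normal B (firstIndex M)
  set s' := normal B (secondIndex M)
  have hhalf : ((M / 2 : ℕ) : ℝ) = (M : ℝ) / 2 := by
    rw [Nat.cast_div_charZero hM.two_dvd]
    norm_num
  have hs : 3 / 4 * ((M : ℝ) / 2) ≤ s.card := by
    have h1 := le_card_normal B (firstIndex M)
    rw [hhalf] at h1
    nlinarith
  have hsN : (s.card : ℝ) ≤ M / 2 := hhalf ▸ card_normal_le B (firstIndex M)
  have hsN' : (s'.card : ℝ) ≤ M / 2 := hhalf ▸ card_normal_le B (secondIndex M)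
  have hprob : ∀ Y : U → Ξ → ℝ, Measurable (Function.uncurry Y) →
      (∀ ω, Integrable (Y (u ω)) 𝒟) → (∀ ω, ∫ x, Y (u ω) x ∂𝒟 = 0) →
      (∀ ω, (fun x => Y (u ω) x ^ 2) = fun x => (h (u ω) x - G (u ω)) ^ 2) →
      μ.real {ω | Overshoot s s' (ε * (M / 2)) (cappedQuantile (𝒟.map (Y (u ω))) (4 * ε) K) K
        fun i => Y (u ω) (ξ i ω)} ≤ 3 * Real.exp (-(ε * ((M : ℝ) / 2) / 4)) := by
    intro Y hY hY1 hY0 hY2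
    have hA := measurableSet_overshoot hY (measurable_cappedQuantile 𝒟 hY hK (4 * ε)) s s'
      (ε * (M / 2)) K
    have hquery := measureReal_query_le hm' hu (ξ := fun i : {i // i ∉ B} => ξ i.1)
      (fun i => hξ i.1 i.2) (fun i => hlaw i.1 i.2) hindep hpast hA
      (p := 3 * Real.exp (-(ε * ((M : ℝ) / 2) / 4)))
    simp only [Set.mem_ofPred_eq] at hquery
    refine hquery fun ω => ?_
    have hYm : Measurable (Y (u ω)) := hY.comp measurable_prodMk_left
    refine measureReal_overshoot_le hYm (hY1 ω) ?_ (hY0 ω) hK hεpos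
      (by positivity) ?_ hs hsN hsN'
    · rw [hY2]
      exact hint2 ω
    · rw [hY2, hK2]
      exact hvar ω
  have hup := hprob X hX hX1 hX0 fun ω => by rw [hXG]
  have hlo := hprob (fun v x => -X v x) hX' (fun ω => (hX1 ω).neg)
    (fun ω => by rw [integral_neg, hX0, neg_zero]) fun ω => by simp only [hXG, neg_sq]
  refine le_trans (le_trans (measureReal_mono fun ω hω => ?_) (measureReal_union_le _ _))
    ((add_le_add hup hlo).trans (by linarith [six_mul_exp_trimLevel_le hM0 hα0 hδ0 hδ1]))
  by_contra hgood
  simp only [Set.mem_union, not_or, Set.mem_ofPred_eq] at hgood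
  have e1 : (fun i : {i // i ∉ B} => X (u ω) (ξ i ω)) = fun i => z ω i.1 - G (u ω) := by
    ext i
    rw [hXG, hz ω i.1 i.2]
  have e2 : (fun i : {i // i ∉ B} => -X (u ω) (ξ i ω)) = fun i => G (u ω) - z ω i.1 := by
    ext i
    rw [hXG, hz ω i.1 i.2, neg_sub]
  rw [e1, e2] at hgood
  have hmain := abs_trimmedMean_sub_le hM hM0 hB hlog hα0 hε hK (cappedQuantile_le hK)
    (cappedQuantile_le hK) (z ω) hgood.1 hgood.2
  rw [Set.mem_ofPred_eq] at hω
  have : 0 < τ * Real.sqrt ε := by positivity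
  rw [← hεdef, hεK] at hmain
  linarith

/-- The trimmed mean of the messages at a query point that depends on the past only is, with
probability at least `1 - δ`, within `23 τ √ε` of the mean `G`, whatever the Byzantine agents
send. -/
theorem measureReal_trimmedMean_le (hM : Even M) (hM0 : 0 < M)
    (hB : (B.card : ℝ) ≤ α * M) (hα0 : 0 ≤ α) (hα1 : α < 1 / 16) (hδ0 : 0 < δ) (hδ1 : δ ≤ 1)
    (hε : trimLevel M α δ ≤ 1 / 2) (hm' : m' ≤ mΩ)
    {u : Ω → U} (hu : Measurable[m'] u) {ξ : Fin M → Ω → Ξ} (hξ : ∀ i ∉ B, Measurable (ξ i))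
    (hlaw : ∀ i ∉ B, μ.map (ξ i) = 𝒟) (hindep : iIndepFun (fun i : {i // i ∉ B} => ξ i) μ)
    (hpast : Indep (MeasurableSpace.comap (fun ω (i : {i // i ∉ B}) => ξ i ω) inferInstance) m' μ)
    {h : U → Ξ → ℝ} (hh : Measurable (Function.uncurry h)) {G : U → ℝ} {τ : ℝ}
    (hint : ∀ ω, Integrable (h (u ω)) 𝒟) (hmean : ∀ ω, ∫ x, h (u ω) x ∂𝒟 = G (u ω))
    (hint2 : ∀ ω, Integrable (fun x => (h (u ω) x - G (u ω)) ^ 2) 𝒟)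
    (hvar : ∀ ω, ∫ x, (h (u ω) x - G (u ω)) ^ 2 ∂𝒟 ≤ τ ^ 2)
    {z : Ω → Fin M → ℝ} (hz : ∀ ω, ∀ i ∉ B, z ω i = h (u ω) (ξ i ω)) :
    μ.real {ω | 23 * (|τ| * Real.sqrt (trimLevel M α δ)) <
      |trimmedMean α δ (z ω) - G (u ω)|} ≤ δ := by
  -- the case `τ = 0` is the limit of the bounds for the levels `|τ| + 1 / (k + 1)`
  set E : ℕ → Set Ω := fun k => {ω | 23 * ((|τ| + 1 / ((k : ℝ) + 1)) *
    Real.sqrt (trimLevel M α δ)) < |trimmedMean α δ (z ω) - G (u ω)|} with hE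
  have hEk : ∀ k, μ.real (E k) ≤ δ := fun k => by
    have hk : (0 : ℝ) < 1 / ((k : ℝ) + 1) := by positivity
    have hpos : 0 < |τ| + 1 / ((k : ℝ) + 1) := by positivity
    refine measureReal_trimmedMean_of_pos hM hM0 hB hα0 hα1 hδ0 hδ1 hε hm' hu hξ hlaw hindep hpast
      hh hpos hint hmean hint2 (fun ω => (hvar ω).trans ?_) hz
    rw [← sq_abs τ]
    exact pow_le_pow_left₀ (abs_nonneg _) (by linarith) 2
  have hmono : Monotone E := fun k l hkl ω hω => by
    rw [hE, Set.mem_ofPred_eq] at hω ⊢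
    refine lt_of_le_of_lt ?_ hω
    gcongr
  have hlim : Filter.Tendsto (fun k : ℕ => 23 * ((|τ| + 1 / ((k : ℝ) + 1)) *
      Real.sqrt (trimLevel M α δ))) Filter.atTop
      (nhds (23 * ((|τ| + 0) * Real.sqrt (trimLevel M α δ)))) :=
    ((tendsto_one_div_add_atTop_nhds_zero_nat.const_add _).mul_const _).const_mul _
  have htends := tendsto_measure_iUnion_atTop (μ := μ) hmono
  refine (measureReal_mono (s₂ := ⋃ k, E k) fun ω hω => ?_).trans
    (le_of_tendsto' ((ENNReal.tendsto_toReal (measure_ne_top _ _)).comp htends) hEk)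
  rw [add_zero] at hlim
  obtain ⟨k, hk⟩ := (hlim.eventually (gt_mem_nhds hω)).exists
  exact Set.mem_iUnion.2 ⟨k, hk⟩

end Stage

/-! ### Euclidean projection -/

section Projection

open scoped RealInnerProductSpace

variable {k : ℕ} {K : Set (Vec k)}

theorem proj_spec (hne : K.Nonempty) (hc : IsCompact K) (u : Vec k) :
    proj K u ∈ K ∧ ∀ w ∈ K, ‖u - proj K u‖ ≤ ‖u - w‖ := by
  obtain ⟨v, hv, hmin⟩ := hc.exists_isMinOn hne
    (continuous_const.sub continuous_id).norm.continuousOn (f := fun w => ‖u - w‖)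
  exact Classical.epsilon_spec (p := fun v => v ∈ K ∧ ∀ w ∈ K, ‖u - v‖ ≤ ‖u - w‖)
    ⟨v, hv, fun w hw => hmin hw⟩

theorem inner_proj_le_zero (hne : K.Nonempty) (hc : IsCompact K) (hK : Convex ℝ K) (u : Vec k)
    {w : Vec k} (hw : w ∈ K) : ⟪u - proj K u, w - proj K u⟫ ≤ 0 := by
  obtain ⟨hmem, hmin⟩ := proj_spec hne hc u
  refine (norm_eq_iInf_iff_real_inner_le_zero hK hmem).1 ?_ w hw
  have : Nonempty K := ⟨⟨_, hmem⟩⟩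
  refine le_antisymm (le_ciInf fun w => hmin w w.2) ?_
  exact ciInf_le ⟨0, Set.forall_mem_range.2 fun w => norm_nonneg _⟩ (⟨_, hmem⟩ : K)

theorem continuous_proj (hne : K.Nonempty) (hc : IsCompact K) (hK : Convex ℝ K) :
    Continuous (proj K) := by
  refine LipschitzWith.continuous (K := 1) (LipschitzWith.of_dist_le_mul fun u v => ?_)
  rw [NNReal.coe_one, one_mul, dist_eq_norm, dist_eq_norm]
  have h1 := inner_proj_le_zero hne hc hK u (proj_spec hne hc v).1
  have h2 := inner_proj_le_zero hne hc hK v (proj_spec hne hc u).1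
  set p := proj K u
  set q := proj K v
  have h3 : ‖p - q‖ ^ 2 ≤ ⟪u - v, p - q⟫ := by
    rw [← real_inner_self_eq_norm_sq]
    simp only [inner_sub_left, inner_sub_right] at h1 h2 ⊢
    linarith
  have h4 := real_inner_le_norm (u - v) (p - q)
  by_contra! hlt
  have : 0 < ‖p - q‖ := (norm_nonneg _).trans_lt hlt
  nlinarith

/-- The three-point inequality of the proximal step. -/
theorem inner_proj_step_le (hne : K.Nonempty) (hc : IsCompact K) (hK : Convex ℝ K)
    (z v : Vec k) {w : Vec k} (hw : w ∈ K) :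
    ⟪v, proj K (z - v) - w⟫ ≤
      (‖z - w‖ ^ 2 - ‖proj K (z - v) - w‖ ^ 2 - ‖z - proj K (z - v)‖ ^ 2) / 2 := by
  have h := inner_proj_le_zero hne hc hK (z - v) hw
  set p := proj K (z - v)
  have h1 : ‖z - w‖ ^ 2 = ‖z - p‖ ^ 2 + 2 * ⟪z - p, p - w⟫ + ‖p - w‖ ^ 2 := by
    rw [← norm_add_sq_real, sub_add_sub_cancel]
  have h2 : ⟪z - v - p, w - p⟫ = ⟪v, p - w⟫ - ⟪z - p, p - w⟫ := by
    simp only [inner_sub_left, inner_sub_right]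
    ring
  linarith

/-! ### One extragradient step -/

/-- One block of an extragradient step with the gradients `v₁` at the iterate `z` and `v₂` at the
mid-point, which approximate the exact gradients `G₁` and `G₂` up to `E`. -/
theorem extragradient_step_le (hne : K.Nonempty) (hc : IsCompact K) (hK : Convex ℝ K)
    {η E D : ℝ} (hη : 0 ≤ η) (hE : 0 ≤ E) (hD : ∀ p ∈ K, ∀ q ∈ K, ‖p - q‖ ≤ D)
    {z v₁ v₂ G₁ G₂ : Vec k} (h₁ : ‖v₁ - G₁‖ ≤ E) (h₂ : ‖v₂ - G₂‖ ≤ E)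
    {zhat znext : Vec k} (hzhat : zhat = proj K (z - η • v₁)) (hznext : znext = proj K (z - η • v₂))
    {w : Vec k} (hw : w ∈ K) :
    η * ⟪G₂, zhat - w⟫ ≤ (‖z - w‖ ^ 2 - ‖znext - w‖ ^ 2) / 2 - ‖z - zhat‖ ^ 2 / 2 -
      ‖zhat - znext‖ ^ 2 / 2 + η * (‖G₁ - G₂‖ * ‖zhat - znext‖) + 3 * (η * (E * D)) := by
  have hzhatK : zhat ∈ K := hzhat ▸ (proj_spec hne hc _).1
  have hznextK : znext ∈ K := hznext ▸ (proj_spec hne hc _).1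
  have a1 := inner_proj_step_le hne hc hK z (η • v₁) hznextK
  have a2 := inner_proj_step_le hne hc hK z (η • v₂) hw
  rw [← hzhat] at a1
  rw [← hznext] at a2
  rw [real_inner_smul_left] at a1 a2
  have hcs : ∀ a b : Vec k, ∀ A C : ℝ, ‖a‖ ≤ A → ‖b‖ ≤ C → 0 ≤ A → ⟪a, b⟫ ≤ A * C :=
    fun a b A C ha hb hA => (real_inner_le_norm a b).trans
      (mul_le_mul ha hb (norm_nonneg _) hA)
  have e1 := hcs (G₂ - v₂) (zhat - w) E D (by rwa [norm_sub_rev]) (hD _ hzhatK _ hw) hE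
  have e2 := hcs (v₂ - G₂) (zhat - znext) E D h₂ (hD _ hzhatK _ hznextK) hE
  have e3 := hcs (G₁ - v₁) (zhat - znext) E D (by rwa [norm_sub_rev]) (hD _ hzhatK _ hznextK) hE
  have e4 := hcs (G₂ - G₁) (zhat - znext) _ _ (norm_sub_rev G₂ G₁).le le_rfl (norm_nonneg _)
  have key : ⟪G₂, zhat - w⟫ = ⟪v₁, zhat - znext⟫ + ⟪v₂, znext - w⟫ + ⟪G₂ - v₂, zhat - w⟫ +
      ⟪v₂ - G₂, zhat - znext⟫ + ⟪G₁ - v₁, zhat - znext⟫ + ⟪G₂ - G₁, zhat - znext⟫ := by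
    simp only [inner_sub_left, inner_sub_right]
    ring
  have hsum : ⟪G₂, zhat - w⟫ ≤ ⟪v₁, zhat - znext⟫ + ⟪v₂, znext - w⟫ +
      (‖G₁ - G₂‖ * ‖zhat - znext‖ + 3 * (E * D)) := by linarith
  have hmul := mul_le_mul_of_nonneg_left hsum hη
  rw [mul_add, mul_add, mul_add] at hmul
  linarith

end Projection

/-! ### First-order characterisation of convexity on a convex set -/

open scoped RealInnerProductSpace in
theorem add_inner_le_of_convexOn {k : ℕ} {K : Set (Vec k)} {φ : Vec k → ℝ} (hφ : ConvexOn ℝ K φ)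
    {x w G : Vec k} (hx : x ∈ K) (hw : w ∈ K) (hG : HasGradientWithinAt φ G K x) :
    φ x + ⟪G, w - x⟫ ≤ φ w := by
  have hmaps : Set.MapsTo (AffineMap.lineMap x w : ℝ →ᵃ[ℝ] Vec k) (Set.Icc (0 : ℝ) 1) K :=
    fun t ht => hφ.1.lineMap_mem hx hw ht
  have hconv : ConvexOn ℝ (Set.Icc (0 : ℝ) 1) (φ ∘ (AffineMap.lineMap x w : ℝ →ᵃ[ℝ] Vec k)) :=
    (hφ.comp_affineMap _).subset hmaps (convex_Icc 0 1)
  have hline : HasDerivWithinAt (AffineMap.lineMap x w : ℝ →ᵃ[ℝ] Vec k) (w - x)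
      (Set.Icc (0 : ℝ) 1) 0 := AffineMap.hasDerivWithinAt_lineMap
  have hG' : HasFDerivWithinAt φ (InnerProductSpace.toDual ℝ (Vec k) G) K
      (AffineMap.lineMap x w (0 : ℝ)) := by
    rw [AffineMap.lineMap_apply_zero]
    exact hG.hasFDerivWithinAt
  have hderiv := hG'.comp_hasDerivWithinAt (0 : ℝ) hline hmaps
  have := hconv.le_slope_of_hasDerivWithinAt (Set.left_mem_Icc.2 zero_le_one)
    (Set.right_mem_Icc.2 zero_le_one) zero_lt_one hderiv
  rw [InnerProductSpace.toDual_apply_apply, slope_def_field] at this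
  simp only [Function.comp_apply, AffineMap.lineMap_apply_zero, AffineMap.lineMap_apply_one] at this
  norm_num at this
  linarith

/-! ### The primal-dual gap of extragradient with inexact gradients -/

section Gap

open scoped RealInnerProductSpace

variable {n m M : ℕ} {X : Set (Vec n)} {Y : Set (Vec m)} {η α δ : ℝ}
  {rx : ℕ → Vec n → Vec m → Fin M → Vec n} {ry : ℕ → Vec n → Vec m → Fin M → Vec m}
  {z₁ : Vec n × Vec m}

theorem update_mem (hX : X.Nonempty) (hY : Y.Nonempty) (hXc : IsCompact X) (hYc : IsCompact Y)
    (rx : Vec n → Vec m → Fin M → Vec n) (ry : Vec n → Vec m → Fin M → Vec m)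
    (z u : Vec n × Vec m) : update X Y η α δ rx ry z u ∈ X ×ˢ Y :=
  ⟨(proj_spec hX hXc _).1, (proj_spec hY hYc _).1⟩

theorem iterate_mem (hXc : IsCompact X) (hYc : IsCompact Y) (hz : z₁ ∈ X ×ˢ Y) (t : ℕ) :
    iterate X Y η α δ rx ry z₁ t ∈ X ×ˢ Y := by
  cases t with
  | zero => exact hz
  | succ t => exact update_mem ⟨_, hz.1⟩ ⟨_, hz.2⟩ hXc hYc _ _ _ _

theorem midpoint_mem (hXc : IsCompact X) (hYc : IsCompact Y) (hz : z₁ ∈ X ×ˢ Y) (t : ℕ) :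
    midpoint X Y η α δ rx ry z₁ t ∈ X ×ˢ Y :=
  update_mem ⟨_, hz.1⟩ ⟨_, hz.2⟩ hXc hYc _ _ _ _

variable {f : Vec n → Vec m → ℝ} {Gx : Vec n → Vec m → Vec n} {Gy : Vec n → Vec m → Vec m}

/-- The decrease of the distance to `(w, v)` in one round; the smoothness terms are absorbed since
`η ≤ 1 / (2 L)`. -/
theorem inner_midpoint_le (hXc : IsCompact X) (hYc : IsCompact Y)
    (hX : Convex ℝ X) (hY : Convex ℝ Y) {L : ℝ} (hL : 0 < L)
    (hLx : ∀ x₁ ∈ X, ∀ x₂ ∈ X, ∀ y₁ ∈ Y, ∀ y₂ ∈ Y,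
      ‖Gx x₁ y₁ - Gx x₂ y₂‖ ≤ L * (‖x₁ - x₂‖ + ‖y₁ - y₂‖))
    (hLy : ∀ x₁ ∈ X, ∀ x₂ ∈ X, ∀ y₁ ∈ Y, ∀ y₂ ∈ Y,
      ‖Gy x₁ y₁ - Gy x₂ y₂‖ ≤ L * (‖x₁ - x₂‖ + ‖y₁ - y₂‖))
    (hη₀ : 0 < η) (hη : η ≤ 1 / (2 * L)) {E D : ℝ} (hE : 0 ≤ E)
    (hDX : ∀ p ∈ X, ∀ q ∈ X, ‖p - q‖ ≤ D) (hDY : ∀ p ∈ Y, ∀ q ∈ Y, ‖p - q‖ ≤ D)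
    (hz : z₁ ∈ X ×ˢ Y) {t : ℕ} {z zhat znext : Vec n × Vec m}
    (hzdef : z = iterate X Y η α δ rx ry z₁ t) (hzhat : zhat = midpoint X Y η α δ rx ry z₁ t)
    (hznext : znext = iterate X Y η α δ rx ry z₁ (t + 1))
    (h1 : ‖trim α δ (rx (2 * t) z.1 z.2) - Gx z.1 z.2‖ ≤ E)
    (h2 : ‖trim α δ (ry (2 * t) z.1 z.2) - Gy z.1 z.2‖ ≤ E)
    (h3 : ‖trim α δ (rx (2 * t + 1) zhat.1 zhat.2) - Gx zhat.1 zhat.2‖ ≤ E)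
    (h4 : ‖trim α δ (ry (2 * t + 1) zhat.1 zhat.2) - Gy zhat.1 zhat.2‖ ≤ E)
    {w : Vec n} (hw : w ∈ X) {v : Vec m} (hv : v ∈ Y) :
    η * (⟪Gx zhat.1 zhat.2, zhat.1 - w⟫ - ⟪Gy zhat.1 zhat.2, zhat.2 - v⟫) ≤
      (‖z.1 - w‖ ^ 2 + ‖z.2 - v‖ ^ 2) / 2 - (‖znext.1 - w‖ ^ 2 + ‖znext.2 - v‖ ^ 2) / 2 +
        6 * (η * (E * D)) := by
  have hzm : z ∈ X ×ˢ Y := hzdef ▸ iterate_mem hXc hYc hz t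
  have hzhm : zhat ∈ X ×ˢ Y := hzhat ▸ midpoint_mem hXc hYc hz t
  have ex : zhat.1 = proj X (z.1 - η • trim α δ (rx (2 * t) z.1 z.2)) := by
    rw [hzhat, hzdef]; rfl
  have ey : zhat.2 = proj Y (z.2 - η • -trim α δ (ry (2 * t) z.1 z.2)) := by
    rw [smul_neg, sub_neg_eq_add, hzhat, hzdef]; rfl
  have ex' : znext.1 = proj X (z.1 - η • trim α δ (rx (2 * t + 1) zhat.1 zhat.2)) := by
    rw [hznext, hzhat, hzdef]; rfl
  have ey' : znext.2 = proj Y (z.2 - η • -trim α δ (ry (2 * t + 1) zhat.1 zhat.2)) := by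
    rw [smul_neg, sub_neg_eq_add, hznext, hzhat, hzdef]; rfl
  have sx := extragradient_step_le ⟨_, hw⟩ hXc hX hη₀.le hE hDX h1 h3 ex ex' hw
  have sy := extragradient_step_le (G₁ := -Gy z.1 z.2) (G₂ := -Gy zhat.1 zhat.2) ⟨_, hv⟩ hYc hY
    hη₀.le hE hDY (by rwa [neg_sub_neg, norm_sub_rev]) (by rwa [neg_sub_neg, norm_sub_rev])
    ey ey' hv
  rw [neg_sub_neg, norm_sub_rev (Gy zhat.1 zhat.2), inner_neg_left] at sy
  have lx := hLx _ hzm.1 _ hzhm.1 _ hzm.2 _ hzhm.2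
  have ly := hLy _ hzm.1 _ hzhm.1 _ hzm.2 _ hzhm.2
  have hηL : η * L ≤ 1 / 2 := by
    rw [le_div_iff₀ (by positivity)] at hη
    linarith
  set a := ‖z.1 - zhat.1‖
  set b := ‖z.2 - zhat.2‖
  set c := ‖zhat.1 - znext.1‖
  set d := ‖zhat.2 - znext.2‖
  have ha : 0 ≤ a := norm_nonneg _
  have hb : 0 ≤ b := norm_nonneg _
  have hc : 0 ≤ c := norm_nonneg _
  have hd : 0 ≤ d := norm_nonneg _
  have hcross : η * (‖Gx z.1 z.2 - Gx zhat.1 zhat.2‖ * c) +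
      η * (‖Gy z.1 z.2 - Gy zhat.1 zhat.2‖ * d) ≤
      a ^ 2 / 2 + b ^ 2 / 2 + c ^ 2 / 2 + d ^ 2 / 2 := by
    calc _ ≤ η * (L * (a + b) * c) + η * (L * (a + b) * d) := by gcongr
      _ = η * L * ((a + b) * (c + d)) := by ring
      _ ≤ 1 / 2 * ((a + b) * (c + d)) := by gcongr
      _ ≤ _ := by nlinarith [sq_nonneg (a + b - (c + d)), sq_nonneg (a - b), sq_nonneg (c - d)]
  linarith

/-- If all robust gradients of the first `T` rounds are accurate up to `E`, the averaged mid-points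
have a small gap. -/
theorem gap_avgMidpoint_le {T : ℕ} (hT : 0 < T) (hXc : IsCompact X) (hYc : IsCompact Y)
    (hX : Convex ℝ X) (hY : Convex ℝ Y)
    (hGx : ∀ x ∈ X, ∀ y ∈ Y, HasGradientWithinAt (fun x' => f x' y) (Gx x y) X x)
    (hGy : ∀ x ∈ X, ∀ y ∈ Y, HasGradientWithinAt (fun y' => f x y') (Gy x y) Y y)
    (hconvex : ∀ y ∈ Y, ConvexOn ℝ X (fun x => f x y))
    (hconcave : ∀ x ∈ X, ConcaveOn ℝ Y (fun y => f x y)) {L : ℝ} (hL : 0 < L)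
    (hLx : ∀ x₁ ∈ X, ∀ x₂ ∈ X, ∀ y₁ ∈ Y, ∀ y₂ ∈ Y,
      ‖Gx x₁ y₁ - Gx x₂ y₂‖ ≤ L * (‖x₁ - x₂‖ + ‖y₁ - y₂‖))
    (hLy : ∀ x₁ ∈ X, ∀ x₂ ∈ X, ∀ y₁ ∈ Y, ∀ y₂ ∈ Y,
      ‖Gy x₁ y₁ - Gy x₂ y₂‖ ≤ L * (‖x₁ - x₂‖ + ‖y₁ - y₂‖))
    (hη₀ : 0 < η) (hη : η ≤ 1 / (2 * L)) {E D : ℝ} (hE : 0 ≤ E)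
    (hDX : ∀ p ∈ X, ∀ q ∈ X, ‖p - q‖ ≤ D) (hDY : ∀ p ∈ Y, ∀ q ∈ Y, ‖p - q‖ ≤ D)
    (hz : z₁ ∈ X ×ˢ Y)
    (hiter : ∀ t < T, ∀ z, z = iterate X Y η α δ rx ry z₁ t →
      ‖trim α δ (rx (2 * t) z.1 z.2) - Gx z.1 z.2‖ ≤ E ∧
        ‖trim α δ (ry (2 * t) z.1 z.2) - Gy z.1 z.2‖ ≤ E)
    (hmid : ∀ t < T, ∀ z, z = midpoint X Y η α δ rx ry z₁ t →
      ‖trim α δ (rx (2 * t + 1) z.1 z.2) - Gx z.1 z.2‖ ≤ E ∧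
        ‖trim α δ (ry (2 * t + 1) z.1 z.2) - Gy z.1 z.2‖ ≤ E) :
    gap X Y f (avgMidpoint X Y η α δ rx ry z₁ T) ≤ D ^ 2 / (η * T) + 6 * (E * D) := by
  have hTpos : (0 : ℝ) < T := by exact_mod_cast hT
  set zhat := midpoint X Y η α δ rx ry z₁ with hzhat
  set zbar := avgMidpoint X Y η α δ rx ry z₁ T with hzbar
  have hmem : ∀ t, zhat t ∈ X ×ˢ Y := fun t => midpoint_mem hXc hYc hz t
  have hw0 : ∀ t ∈ Finset.range T, (0 : ℝ) ≤ 1 / T := fun _ _ => by positivity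
  have hw1 : ∑ _t ∈ Finset.range T, (1 : ℝ) / T = 1 := by
    rw [Finset.sum_const, Finset.card_range, nsmul_eq_mul]
    field_simp
  have hbar1 : zbar.1 = ∑ t ∈ Finset.range T, (1 / (T : ℝ)) • (zhat t).1 := by
    rw [hzbar, avgMidpoint, Prod.smul_fst, Prod.fst_sum, Finset.smul_sum]
  have hbar2 : zbar.2 = ∑ t ∈ Finset.range T, (1 / (T : ℝ)) • (zhat t).2 := by
    rw [hzbar, avgMidpoint, Prod.smul_snd, Prod.snd_sum, Finset.smul_sum]
  have hpair : ∀ w ∈ X, ∀ v ∈ Y, f zbar.1 v - f w zbar.2 ≤ D ^ 2 / (η * T) + 6 * (E * D) := by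
    intro w hw v hv
    have j1 : f zbar.1 v ≤ ∑ t ∈ Finset.range T, 1 / (T : ℝ) * f (zhat t).1 v := by
      rw [hbar1]
      exact (hconvex v hv).map_sum_le hw0 hw1 fun t _ => (hmem t).1
    have j2 : ∑ t ∈ Finset.range T, 1 / (T : ℝ) * f w (zhat t).2 ≤ f w zbar.2 := by
      rw [hbar2]
      exact (hconcave w hw).le_map_sum hw0 hw1 fun t _ => (hmem t).2
    set Φ : ℕ → ℝ := fun t => (‖(iterate X Y η α δ rx ry z₁ t).1 - w‖ ^ 2 +
      ‖(iterate X Y η α δ rx ry z₁ t).2 - v‖ ^ 2) / 2 with hΦ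
    have hround : ∀ t ∈ Finset.range T, η * (f (zhat t).1 v - f w (zhat t).2) ≤
        (Φ t - Φ (t + 1)) + 6 * (η * (E * D)) := by
      intro t ht
      obtain ⟨i1, i2⟩ := hiter t (Finset.mem_range.1 ht) _ rfl
      obtain ⟨i3, i4⟩ := hmid t (Finset.mem_range.1 ht) _ rfl
      have hstep := inner_midpoint_le hXc hYc hX hY hL hLx hLy hη₀ hη hE hDX hDY hz rfl rfl rfl
        i1 i2 i3 i4 hw hv
      have c1 := add_inner_le_of_convexOn (hconvex _ (hmem t).2) (hmem t).1 hw
        (hGx _ (hmem t).1 _ (hmem t).2)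
      have hneg : HasGradientWithinAt (-fun y' => f (zhat t).1 y')
          (-Gy (zhat t).1 (zhat t).2) Y (zhat t).2 := by
        have := (hGy _ (hmem t).1 _ (hmem t).2).hasFDerivWithinAt.neg
        rw [← map_neg] at this
        exact this
      have c2 := add_inner_le_of_convexOn (hconcave _ (hmem t).1).neg (hmem t).2 hv hneg
      simp only [Pi.neg_apply] at c2
      have e1 : ⟪Gx (zhat t).1 (zhat t).2, w - (zhat t).1⟫ =
          -⟪Gx (zhat t).1 (zhat t).2, (zhat t).1 - w⟫ := by rw [← inner_neg_right, neg_sub]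
      have e2 : ⟪-Gy (zhat t).1 (zhat t).2, v - (zhat t).2⟫ =
          ⟪Gy (zhat t).1 (zhat t).2, (zhat t).2 - v⟫ := by
        rw [← neg_sub, inner_neg_neg]
      refine le_trans (mul_le_mul_of_nonneg_left ?_ hη₀.le) hstep
      linarith
    have hsum := Finset.sum_le_sum hround
    rw [← Finset.mul_sum, Finset.sum_add_distrib, Finset.sum_range_sub', Finset.sum_const,
      Finset.card_range, nsmul_eq_mul] at hsum
    have hΦ0 : Φ 0 ≤ D ^ 2 := by
      have d1 := pow_le_pow_left₀ (norm_nonneg _) (hDX _ hz.1 _ hw) 2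
      have d2 := pow_le_pow_left₀ (norm_nonneg _) (hDY _ hz.2 _ hv) 2
      change (‖z₁.1 - w‖ ^ 2 + ‖z₁.2 - v‖ ^ 2) / 2 ≤ D ^ 2
      linarith
    have hΦT : 0 ≤ Φ T := by positivity
    rw [← Finset.mul_sum] at j1 j2
    rw [Finset.sum_sub_distrib] at hsum
    set S₁ := ∑ t ∈ Finset.range T, f (zhat t).1 v
    set S₂ := ∑ t ∈ Finset.range T, f w (zhat t).2
    calc f zbar.1 v - f w zbar.2 ≤ η * (S₁ - S₂) / (η * T) := by
          have hscale : η * (S₁ - S₂) / (η * T) = 1 / (T : ℝ) * S₁ - 1 / (T : ℝ) * S₂ := by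
            field_simp
          rw [hscale]
          linarith
      _ ≤ (D ^ 2 + T * (6 * (η * (E * D)))) / (η * T) := by
          gcongr
          linarith
      _ = D ^ 2 / (η * T) + 6 * (E * D) := by
          field_simp
  have hXne : X.Nonempty := ⟨_, hz.1⟩
  have hYne : Y.Nonempty := ⟨_, hz.2⟩
  have hsup : sSup ((fun y => f zbar.1 y) '' Y) ≤
      D ^ 2 / (η * T) + 6 * (E * D) + sInf ((fun x => f x zbar.2) '' X) := by
    refine csSup_le (hYne.image _) ?_
    rintro _ ⟨v, hv, rfl⟩
    rw [← sub_le_iff_le_add']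
    refine le_csInf (hXne.image _) ?_
    rintro _ ⟨w, hw, rfl⟩
    have := hpair w hw v hv
    dsimp only
    linarith
  rw [gap]
  linarith

end Gap

/-! ### Measurability of the run -/

section Measurability

variable {n m M : ℕ} {Ξ Ω : Type*} [MeasurableSpace Ξ]

theorem measurable_trim {k : ℕ} {m' : MeasurableSpace Ω} {α δ : ℝ} {v : Ω → Fin M → Vec k}
    (hv : ∀ i, Measurable[m'] fun ω => v ω i) : Measurable[m'] fun ω => trim α δ (v ω) := by
  refine (WithLp.measurable_toLp 2 _).comp (measurable_pi_lambda _ fun j => ?_)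
  exact (measurable_trimmedMean α δ).comp (measurable_pi_lambda _ fun i =>
    (by fun_prop : Measurable fun w : Vec k => w j).comp (hv i))

theorem measurable_messages {k : ℕ} {m' : MeasurableSpace Ω} {B : Finset (Fin M)}
    {g : Vec n → Vec m → Ξ → Vec k} (hg : Measurable fun p : Vec n × Vec m × Ξ => g p.1 p.2.1 p.2.2)
    {ξ : ℕ → Fin M → Ω → Ξ} {b : ℕ → Fin M → Ω → Vec k} {s : ℕ}
    (hξ : ∀ i ∉ B, Measurable[m'] (ξ s i)) (hb : ∀ i ∈ B, Measurable[m'] (b s i))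
    {u : Ω → Vec n × Vec m} (hu : Measurable[m'] u) (i : Fin M) :
    Measurable[m'] fun ω => messages B g ξ b ω s (u ω).1 (u ω).2 i := by
  by_cases hi : i ∈ B
  · simp only [messages, if_pos hi]
    exact hb i hi
  · simp only [messages, if_neg hi]
    exact hg.comp ((measurable_fst.comp hu).prodMk ((measurable_snd.comp hu).prodMk (hξ i hi)))

variable [mΩ : MeasurableSpace Ω] {μ : Measure Ω} {𝒟 : Measure Ξ}
  {X : Set (Vec n)} {Y : Set (Vec m)}
  {gx : Vec n → Vec m → Ξ → Vec n} {gy : Vec n → Vec m → Ξ → Vec m} {B : Finset (Fin M)}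
  {ℱ : Filtration ℕ mΩ} {ξ : ℕ → Fin M → Ω → Ξ} {bx : ℕ → Fin M → Ω → Vec n}
  {bz : ℕ → Fin M → Ω → Vec m} {η α δ : ℝ} {z₁ : Vec n × Vec m}

theorem measurable_update (hXne : X.Nonempty) (hYne : Y.Nonempty) (hXc : IsCompact X)
    (hYc : IsCompact Y) (hX : Convex ℝ X) (hY : Convex ℝ Y)
    (hgx : Measurable fun p : Vec n × Vec m × Ξ => gx p.1 p.2.1 p.2.2)
    (hgy : Measurable fun p : Vec n × Vec m × Ξ => gy p.1 p.2.1 p.2.2)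
    (hexec : IsExecution μ 𝒟 B ℱ ξ bx bz) {s : ℕ} {z u : Ω → Vec n × Vec m}
    (hz : Measurable[ℱ (s + 1)] z) (hu : Measurable[ℱ (s + 1)] u) :
    Measurable[ℱ (s + 1)] fun ω => update X Y η α δ (messages B gx ξ bx ω s)
      (messages B gy ξ bz ω s) (z ω) (u ω) := by
  have hx := measurable_trim (α := α) (δ := δ) (measurable_messages hgx
    (hexec.sample_measurable s) (hexec.byzantine_measurable_x s) hu)
  have hy := measurable_trim (α := α) (δ := δ) (measurable_messages hgy
    (hexec.sample_measurable s) (hexec.byzantine_measurable_y s) hu)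
  have px := (continuous_proj hXne hXc hX).measurable
  have py := (continuous_proj hYne hYc hY).measurable
  exact (px.comp ((measurable_fst.comp hz).sub (hx.const_smul η))).prodMk
    (py.comp ((measurable_snd.comp hz).add (hy.const_smul η)))

theorem measurable_midpoint_of_iterate (hXc : IsCompact X) (hYc : IsCompact Y) (hX : Convex ℝ X)
    (hY : Convex ℝ Y)
    (hgx : Measurable fun p : Vec n × Vec m × Ξ => gx p.1 p.2.1 p.2.2)
    (hgy : Measurable fun p : Vec n × Vec m × Ξ => gy p.1 p.2.1 p.2.2)
    (hexec : IsExecution μ 𝒟 B ℱ ξ bx bz) (hz : z₁ ∈ X ×ˢ Y) {t : ℕ}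
    (h : Measurable[ℱ (2 * t)] fun ω => iterate X Y η α δ (messages B gx ξ bx ω)
      (messages B gy ξ bz ω) z₁ t) :
    Measurable[ℱ (2 * t + 1)] fun ω => midpoint X Y η α δ (messages B gx ξ bx ω)
      (messages B gy ξ bz ω) z₁ t := by
  have h' := h.mono (ℱ.mono (Nat.le_succ _)) le_rfl
  exact measurable_update ⟨_, hz.1⟩ ⟨_, hz.2⟩ hXc hYc hX hY hgx hgy hexec h' h'

/-- The iterate of round `t` depends only on what happened before stage `2 t`. -/
theorem measurable_iterate (hXc : IsCompact X) (hYc : IsCompact Y) (hX : Convex ℝ X)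
    (hY : Convex ℝ Y)
    (hgx : Measurable fun p : Vec n × Vec m × Ξ => gx p.1 p.2.1 p.2.2)
    (hgy : Measurable fun p : Vec n × Vec m × Ξ => gy p.1 p.2.1 p.2.2)
    (hexec : IsExecution μ 𝒟 B ℱ ξ bx bz) (hz : z₁ ∈ X ×ˢ Y) (t : ℕ) :
    Measurable[ℱ (2 * t)] fun ω => iterate X Y η α δ (messages B gx ξ bx ω)
      (messages B gy ξ bz ω) z₁ t := by
  induction t with
  | zero => exact measurable_const
  | succ t ih =>
    have hmid := measurable_midpoint_of_iterate hXc hYc hX hY hgx hgy hexec hz ih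
    exact measurable_update (s := 2 * t + 1) ⟨_, hz.1⟩ ⟨_, hz.2⟩ hXc hYc hX hY hgx hgy hexec
      (ih.mono (ℱ.mono (by omega)) le_rfl) (hmid.mono (ℱ.mono (Nat.le_succ _)) le_rfl)

end Measurability

/-! ### The accuracy of the robust gradients -/

section Accuracy

variable {n m M k : ℕ} {Ξ Ω : Type*} [MeasurableSpace Ξ] [mΩ : MeasurableSpace Ω]
  {μ : Measure Ω} [IsProbabilityMeasure μ] {𝒟 : Measure Ξ} [IsProbabilityMeasure 𝒟]
  {X : Set (Vec n)} {Y : Set (Vec m)} {B : Finset (Fin M)} {ℱ : Filtration ℕ mΩ}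
  {ξ : ℕ → Fin M → Ω → Ξ} {bx : ℕ → Fin M → Ω → Vec n} {bz : ℕ → Fin M → Ω → Vec m} {α δ : ℝ}

theorem measureReal_trim_le (hM : Even M) (hM0 : 0 < M)
    (hB : (B.card : ℝ) ≤ α * M) (hα0 : 0 ≤ α) (hα1 : α < 1 / 16) (hδ0 : 0 < δ) (hδ1 : δ ≤ 1)
    (hε : trimLevel M α δ ≤ 1 / 2) (hexec : IsExecution μ 𝒟 B ℱ ξ bx bz)
    {G : Vec n → Vec m → Vec k} {g : Vec n → Vec m → Ξ → Vec k} {τ : Fin k → ℝ}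
    (hg : IsOracle 𝒟 X Y G g τ) (b : ℕ → Fin M → Ω → Vec k) {s : ℕ} {u : Ω → Vec n × Vec m}
    (hu : Measurable[ℱ s] u) (huXY : ∀ ω, u ω ∈ X ×ˢ Y) :
    μ.real {ω | 23 * (Real.sqrt (∑ j, τ j ^ 2) * Real.sqrt (trimLevel M α δ)) <
      ‖trim α δ (messages B g ξ b ω s (u ω).1 (u ω).2) - G (u ω).1 (u ω).2‖} ≤ k * δ := by
  set r := Real.sqrt (trimLevel M α δ) with hr
  set E : Fin k → Set Ω := fun j => {ω | 23 * (|τ j| * r) <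
    |trimmedMean α δ (fun i => messages B g ξ b ω s (u ω).1 (u ω).2 i j) -
      G (u ω).1 (u ω).2 j|} with hE
  have hEj : ∀ j, μ.real (E j) ≤ δ := by
    intro j
    refine measureReal_trimmedMean_le (h := fun p x => g p.1 p.2 x j)
      (G := fun p => G p.1 p.2 j) hM hM0 hB hα0 hα1 hδ0 hδ1 hε (ℱ.le s) hu
      (fun i hi => (hexec.sample_measurable s i hi).mono (ℱ.le _) le_rfl)
      (hexec.sample_law s) (hexec.sample_indep s) (hexec.sample_indep_past s) ?_ ?_ ?_ ?_ ?_ ?_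
    · have h1 : Measurable fun q : (Vec n × Vec m) × Ξ => g q.1.1 q.1.2 q.2 :=
        hg.measurable.comp (by fun_prop : Measurable fun q : (Vec n × Vec m) × Ξ =>
          (q.1.1, q.1.2, q.2))
      exact (by fun_prop : Measurable fun w : Vec k => w j).comp h1
    · intro ω
      exact (EuclideanSpace.proj (𝕜 := ℝ) j).integrable_comp
        (hg.integrable _ (huXY ω).1 _ (huXY ω).2)
    · intro ω
      have h1 := (EuclideanSpace.proj (𝕜 := ℝ) j).integral_comp_comm
        (hg.integrable _ (huXY ω).1 _ (huXY ω).2)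
      rw [hg.unbiased _ (huXY ω).1 _ (huXY ω).2] at h1
      exact h1
    · exact fun ω => hg.integrable_sq _ (huXY ω).1 _ (huXY ω).2 j
    · exact fun ω => hg.variance_le _ (huXY ω).1 _ (huXY ω).2 j
    · intro ω i hi
      simp only [messages, if_neg hi]
  have hsub : {ω | 23 * (Real.sqrt (∑ j, τ j ^ 2) * r) <
      ‖trim α δ (messages B g ξ b ω s (u ω).1 (u ω).2) - G (u ω).1 (u ω).2‖} ⊆ ⋃ j, E j := by
    intro ω hω
    by_contra hgood
    simp only [hE, Set.mem_iUnion, Set.mem_ofPred_eq, not_exists, not_lt] at hgood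
    refine (Set.mem_ofPred_eq ▸ hω : _ < _).not_ge ?_
    rw [EuclideanSpace.norm_eq]
    refine Real.sqrt_le_iff.2 ⟨by positivity, ?_⟩
    rw [mul_pow, mul_pow, Real.sq_sqrt (Finset.sum_nonneg fun j _ => sq_nonneg _),
      Finset.sum_mul, Finset.mul_sum]
    refine Finset.sum_le_sum fun j _ => ?_
    have h1 := pow_le_pow_left₀ (abs_nonneg _) (hgood j) 2
    rw [mul_pow, mul_pow, sq_abs (τ j)] at h1
    exact h1
  calc _ ≤ μ.real (⋃ j, E j) := measureReal_mono hsub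
    _ ≤ ∑ j, μ.real (E j) := measureReal_iUnion_fintype_le _
    _ ≤ ∑ _j : Fin k, δ := Finset.sum_le_sum fun j _ => hEj j
    _ = k * δ := by simp

end Accuracy

theorem sqrt_trimLevel_le {M d T : ℕ} {α δ : ℝ} (hM : 0 < M) (hd : 0 < d) (hT : 0 < T)
    (hα : 0 ≤ α) (hδ : δ = 1 / (4 * (d : ℝ) * (T : ℝ) ^ 2)) :
    Real.sqrt (trimLevel M α δ) ≤
      9 * (1 + Real.log d + Real.log T) * (Real.sqrt α + Real.sqrt (1 / M)) := by
  have hM' : (0 : ℝ) < M := by exact_mod_cast hM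
  have hd' : (1 : ℝ) ≤ d := by exact_mod_cast hd
  have hT' : (1 : ℝ) ≤ T := by exact_mod_cast hT
  have hd0 := Real.log_nonneg hd'
  have hT0 := Real.log_nonneg hT'
  set Λ := 1 + Real.log d + Real.log T with hΛ
  have hΛ1 : 1 ≤ Λ := by linarith
  have hlog : Real.log (4 / δ) ≤ 3 * Λ := by
    have h1 : 4 / δ = 2 ^ 4 * d * (T : ℝ) ^ 2 := by
      rw [hδ]
      field_simp
      norm_num
    rw [h1, Real.log_mul (by positivity) (by positivity), Real.log_mul (by positivity)
      (by positivity), Real.log_pow, Real.log_pow]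
    push_cast
    linarith [Real.log_two_lt_d9]
  refine Real.sqrt_le_iff.2 ⟨by positivity, ?_⟩
  have hα2 := Real.sq_sqrt hα
  have hM2 := Real.sq_sqrt (show (0 : ℝ) ≤ 1 / M by positivity)
  set a := Real.sqrt α
  set b := Real.sqrt (1 / M)
  have ha : 0 ≤ a := Real.sqrt_nonneg _
  have hb : 0 ≤ b := Real.sqrt_nonneg _
  have hΛ2 : Λ ≤ Λ ^ 2 := by nlinarith
  calc trimLevel M α δ = 8 * a ^ 2 + 24 * (Real.log (4 / δ) * b ^ 2) := by
        rw [trimLevel, hα2, hM2]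
        ring
    _ ≤ 8 * a ^ 2 + 24 * (3 * Λ * b ^ 2) := by gcongr
    _ ≤ 81 * Λ ^ 2 * (a ^ 2 + b ^ 2) := by
        nlinarith [mul_le_mul_of_nonneg_right hΛ2 (sq_nonneg b),
          mul_le_mul_of_nonneg_right (hΛ1.trans hΛ2) (sq_nonneg a), sq_nonneg a, sq_nonneg b]
    _ ≤ 81 * Λ ^ 2 * (a + b) ^ 2 := by
        gcongr
        nlinarith [mul_nonneg ha hb]
    _ = (9 * Λ * (a + b)) ^ 2 := by ring

end RDEG

/-! ### The union bound over the run -/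

theorem theorem1 :
    -- universal constants: the factor `C (1 + log d + log T) ^ p` is the one hidden by `Õ`
    ∃ C : ℝ, 0 < C ∧ ∃ p : ℕ,
      ∀ (n m M T : ℕ) (_hn : 0 < n) (_hm : 0 < m) (_hT : 0 < T) (_hM : Even M)
        -- the min-max problem, with partial gradients `Gx`, `Gy` of `f`
        (X : Set (RDEG.Vec n)) (Y : Set (RDEG.Vec m))
        (_hXc : IsCompact X) (_hYc : IsCompact Y) (_hX : Convex ℝ X) (_hY : Convex ℝ Y)
        (f : RDEG.Vec n → RDEG.Vec m → ℝ)
        (Gx : RDEG.Vec n → RDEG.Vec m → RDEG.Vec n) (Gy : RDEG.Vec n → RDEG.Vec m → RDEG.Vec m)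
        (_hGx : ∀ x ∈ X, ∀ y ∈ Y, HasGradientWithinAt (fun x' => f x' y) (Gx x y) X x)
        (_hGy : ∀ x ∈ X, ∀ y ∈ Y, HasGradientWithinAt (fun y' => f x y') (Gy x y) Y y)
        (_hconvex : ∀ y ∈ Y, ConvexOn ℝ X (fun x => f x y))
        (_hconcave : ∀ x ∈ X, ConcaveOn ℝ Y (fun y => f x y))
        -- smoothness
        (L : ℝ) (_hL : 0 < L)
        (_hLx : ∀ x₁ ∈ X, ∀ x₂ ∈ X, ∀ y₁ ∈ Y, ∀ y₂ ∈ Y,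
          ‖Gx x₁ y₁ - Gx x₂ y₂‖ ≤ L * (‖x₁ - x₂‖ + ‖y₁ - y₂‖))
        (_hLy : ∀ x₁ ∈ X, ∀ x₂ ∈ X, ∀ y₁ ∈ Y, ∀ y₂ ∈ Y,
          ‖Gy x₁ y₁ - Gy x₂ y₂‖ ≤ L * (‖x₁ - x₂‖ + ‖y₁ - y₂‖))
        -- the stochastic oracle
        (Ξ : Type*) [MeasurableSpace Ξ] (𝒟 : Measure Ξ) [IsProbabilityMeasure 𝒟]
        (gx : RDEG.Vec n → RDEG.Vec m → Ξ → RDEG.Vec n)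
        (gy : RDEG.Vec n → RDEG.Vec m → Ξ → RDEG.Vec m)
        (σx : Fin n → ℝ) (σy : Fin m → ℝ)
        (_hgx : RDEG.IsOracle 𝒟 X Y Gx gx σx) (_hgy : RDEG.IsOracle 𝒟 X Y Gy gy σy)
        -- the agents: samples of the normal ones, arbitrary messages of the Byzantine ones
        (Ω : Type*) [mΩ : MeasurableSpace Ω] (μ : Measure Ω) [IsProbabilityMeasure μ]
        (B : Finset (Fin M)) (ℱ : Filtration ℕ mΩ) (ξ : ℕ → Fin M → Ω → Ξ)
        (bx : ℕ → Fin M → Ω → RDEG.Vec n) (bz : ℕ → Fin M → Ω → RDEG.Vec m)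
        (_hexec : RDEG.IsExecution μ 𝒟 B ℱ ξ bx bz)
        -- parameters
        (α δ η : ℝ) (_hα₀ : 0 ≤ α) (_hα₁ : α < 1 / 16) (_hB : (B.card : ℝ) ≤ α * M)
        (_hδ : δ = 1 / (4 * (max n m : ℕ) * (T : ℝ) ^ 2))
        (_hMlarge : 48 * Real.log (16 * (max n m : ℕ) * (T : ℝ) ^ 2) ≤ M)
        -- the lower truncation quantile does not exceed the upper one
        (_hε : RDEG.trimLevel M α δ ≤ 1 / 2)
        (_hη₀ : 0 < η) (_hη : η ≤ 1 / (2 * L))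
        (x₁ : RDEG.Vec n) (y₁ : RDEG.Vec m) (_hx₁ : x₁ ∈ X) (_hy₁ : y₁ ∈ Y)
        (D σ : ℝ) (_hD : D = max (Metric.diam X) (Metric.diam Y))
        (_hσ : σ = max (Real.sqrt (∑ j, σx j ^ 2)) (Real.sqrt (∑ k, σy k ^ 2))),
        1 - 1 / (T : ℝ) ≤ μ.real {ω |
          RDEG.gap X Y f
              (RDEG.avgMidpoint X Y η α δ (RDEG.messages B gx ξ bx ω) (RDEG.messages B gy ξ bz ω)
                (x₁, y₁) T) ≤
            D ^ 2 / (η * T) +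
              C * (1 + Real.log (max n m : ℕ) + Real.log T) ^ p *
                (σ * D * (Real.sqrt α + Real.sqrt (1 / M)))} := by
  refine ⟨1242, by norm_num, 1, ?_⟩
  intro n m M T hn hm hT hM X Y hXc hYc hX hY f Gx Gy hGx hGy hconvex hconcave L hL hLx hLy
    Ξ _ 𝒟 _ gx gy σx σy hgx hgy Ω mΩ μ _ B ℱ ξ bx bz hexec α δ η hα₀ hα₁ hB hδ hMlarge hε hη₀ hη
    x₁ y₁ hx₁ hy₁ D σ hD hσ
  have hd : 0 < max n m := lt_max_of_lt_left hn
  have hd' : (1 : ℝ) ≤ (max n m : ℕ) := by exact_mod_cast hd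
  have hT' : (1 : ℝ) ≤ T := by exact_mod_cast hT
  have hdT : 1 ≤ ((max n m : ℕ) : ℝ) * (T : ℝ) ^ 2 :=
    one_le_mul_of_one_le_of_one_le hd' (one_le_pow₀ hT')
  have hM0 : 0 < M := by
    have h1 : 0 < Real.log (16 * (max n m : ℕ) * (T : ℝ) ^ 2) := Real.log_pos (by linarith)
    have h2 : (0 : ℝ) < M := by linarith
    exact_mod_cast h2
  have hδ0 : 0 < δ := by rw [hδ]; positivity
  have hδ1 : δ ≤ 1 := by
    rw [hδ, div_le_one (by positivity)]
    linarith
  have hz : (x₁, y₁) ∈ X ×ˢ Y := ⟨hx₁, hy₁⟩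
  have hDX : ∀ p ∈ X, ∀ q ∈ X, ‖p - q‖ ≤ D := fun p hp q hq => by
    rw [← dist_eq_norm, hD]
    exact (Metric.dist_le_diam_of_mem hXc.isBounded hp hq).trans (le_max_left _ _)
  have hDY : ∀ p ∈ Y, ∀ q ∈ Y, ‖p - q‖ ≤ D := fun p hp q hq => by
    rw [← dist_eq_norm, hD]
    exact (Metric.dist_le_diam_of_mem hYc.isBounded hp hq).trans (le_max_right _ _)
  have hD0 : 0 ≤ D := (norm_nonneg _).trans (hDX _ hx₁ _ hx₁)
  have hσx : Real.sqrt (∑ j, σx j ^ 2) ≤ σ := hσ ▸ le_max_left _ _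
  have hσy : Real.sqrt (∑ k, σy k ^ 2) ≤ σ := hσ ▸ le_max_right _ _
  have hσ0 : 0 ≤ σ := (Real.sqrt_nonneg _).trans hσx
  set r := Real.sqrt (RDEG.trimLevel M α δ) with hr
  have hr0 : 0 ≤ r := Real.sqrt_nonneg _
  set E := 23 * (σ * r) with hE
  have hE0 : 0 ≤ E := by positivity
  -- the event that the robust gradients of stage `s` are inaccurate at the query point `u`
  set bad : ℕ → (Ω → RDEG.Vec n × RDEG.Vec m) → Set Ω := fun s u =>
    {ω | 23 * (Real.sqrt (∑ j, σx j ^ 2) * r) <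
      ‖RDEG.trim α δ (RDEG.messages B gx ξ bx ω s (u ω).1 (u ω).2) - Gx (u ω).1 (u ω).2‖} ∪
    {ω | 23 * (Real.sqrt (∑ k, σy k ^ 2) * r) <
      ‖RDEG.trim α δ (RDEG.messages B gy ξ bz ω s (u ω).1 (u ω).2) - Gy (u ω).1 (u ω).2‖} with hbad
  have hbad_le : ∀ s u, Measurable[ℱ s] u → (∀ ω, u ω ∈ X ×ˢ Y) →
      μ.real (bad s u) ≤ 2 * (max n m : ℕ) * δ := by
    intro s u hu huXY
    have h1 := RDEG.measureReal_trim_le hM hM0 hB hα₀ hα₁ hδ0 hδ1 hε hexec hgx bx hu huXY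
    have h2 := RDEG.measureReal_trim_le hM hM0 hB hα₀ hα₁ hδ0 hδ1 hε hexec hgy bz hu huXY
    have hn' : (n : ℝ) ≤ (max n m : ℕ) := by exact_mod_cast le_max_left n m
    have hm' : (m : ℝ) ≤ (max n m : ℕ) := by exact_mod_cast le_max_right n m
    calc μ.real (bad s u) ≤ n * δ + m * δ :=
          (measureReal_union_le _ _).trans (add_le_add h1 h2)
      _ ≤ (max n m : ℕ) * δ + (max n m : ℕ) * δ := by gcongr
      _ = 2 * (max n m : ℕ) * δ := by ring
  have hgood : ∀ s u ω, ω ∉ bad s u →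
      ‖RDEG.trim α δ (RDEG.messages B gx ξ bx ω s (u ω).1 (u ω).2) - Gx (u ω).1 (u ω).2‖ ≤ E ∧
      ‖RDEG.trim α δ (RDEG.messages B gy ξ bz ω s (u ω).1 (u ω).2) - Gy (u ω).1 (u ω).2‖ ≤ E := by
    intro s u ω hω
    simp only [hbad, Set.mem_union, Set.mem_ofPred_eq, not_or, not_lt] at hω
    refine ⟨hω.1.trans ?_, hω.2.trans ?_⟩
    · rw [hE]
      gcongr
    · rw [hE]
      gcongr
  set z : ℕ → Ω → RDEG.Vec n × RDEG.Vec m := fun t ω => RDEG.iterate X Y η α δ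
    (RDEG.messages B gx ξ bx ω) (RDEG.messages B gy ξ bz ω) (x₁, y₁) t with hzdef
  set zhat : ℕ → Ω → RDEG.Vec n × RDEG.Vec m := fun t ω => RDEG.midpoint X Y η α δ
    (RDEG.messages B gx ξ bx ω) (RDEG.messages B gy ξ bz ω) (x₁, y₁) t with hzhat
  have hzm : ∀ t, Measurable[ℱ (2 * t)] (z t) := fun t =>
    RDEG.measurable_iterate hXc hYc hX hY hgx.measurable hgy.measurable hexec hz t
  have hzhatm : ∀ t, Measurable[ℱ (2 * t + 1)] (zhat t) := fun t =>
    RDEG.measurable_midpoint_of_iterate hXc hYc hX hY hgx.measurable hgy.measurable hexec hz (hzm t)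
  set Bad := ⋃ t ∈ Finset.range T, bad (2 * t) (z t) ∪ bad (2 * t + 1) (zhat t) with hBad
  have hBad_le : μ.real Bad ≤ 1 / T := by
    calc μ.real Bad ≤ ∑ t ∈ Finset.range T,
          μ.real (bad (2 * t) (z t) ∪ bad (2 * t + 1) (zhat t)) :=
          measureReal_biUnion_finset_le _ _
      _ ≤ ∑ _t ∈ Finset.range T, (2 * (max n m : ℕ) * δ + 2 * (max n m : ℕ) * δ) :=
          Finset.sum_le_sum fun t _ => (measureReal_union_le _ _).trans (add_le_add
            (hbad_le _ _ (hzm t) fun ω => RDEG.iterate_mem hXc hYc hz t)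
            (hbad_le _ _ (hzhatm t) fun ω => RDEG.midpoint_mem hXc hYc hz t))
      _ = 1 / T := by
          rw [Finset.sum_const, Finset.card_range, nsmul_eq_mul, hδ]
          field_simp
          norm_num
  set S := {ω | RDEG.gap X Y f
      (RDEG.avgMidpoint X Y η α δ (RDEG.messages B gx ξ bx ω) (RDEG.messages B gy ξ bz ω)
        (x₁, y₁) T) ≤ D ^ 2 / (η * T) +
      1242 * (1 + Real.log (max n m : ℕ) + Real.log T) ^ 1 *
        (σ * D * (Real.sqrt α + Real.sqrt (1 / M)))} with hS
  have hcover : Set.univ ⊆ S ∪ Bad := by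
    intro ω _
    by_contra hω
    rw [Set.mem_union, not_or] at hω
    obtain ⟨hωS, hωB⟩ := hω
    simp only [hBad, Set.mem_iUnion, Finset.mem_range, Set.mem_union, not_exists, not_or] at hωB
    refine hωS ?_
    rw [hS, Set.mem_ofPred_eq]
    refine (RDEG.gap_avgMidpoint_le hT hXc hYc hX hY hGx hGy hconvex hconcave hL hLx hLy hη₀ hη
      hE0 hDX hDY hz ?_ ?_).trans ?_
    · rintro t ht _ rfl
      exact hgood _ (z t) ω (hωB t ht).1
    · rintro t ht _ rfl
      exact hgood _ (zhat t) ω (hωB t ht).2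
    · have hsqrt := RDEG.sqrt_trimLevel_le hM0 hd hT hα₀ hδ
      have h1 := mul_le_mul_of_nonneg_left hsqrt (show 0 ≤ 138 * (σ * D) by positivity)
      rw [pow_one, hE]
      linarith
  have hone : (1 : ℝ) ≤ μ.real S + μ.real Bad := by
    calc (1 : ℝ) = μ.real Set.univ := probReal_univ.symm
      _ ≤ μ.real (S ∪ Bad) := measureReal_mono hcover
      _ ≤ _ := measureReal_union_le _ _
  linarith
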